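/- Let $N$ be a real vector space of dimension $n$, let $a_1,\dots,a_m\in N$ and $b_1,\dots,b_m\in\mathbb R$, and suppose that $$P=\{u\in N^*:\ \langle a_i,u\rangle+b_i\ge 0,\ i=1,\dots,m\}$$ is a simple polytope: $P$ is nonempty, bounded and $n$-dimensional, each $F_i=P\cap\{\langle a_i,u\rangle+b_i=0\}$ is either empty or $(n-1)$-dimensional, and each vertex of $P$ lies on $F_i$ for exactly $n$ indices $i$. Assume that $m-n=2\ell$ is even. Let $K_P=\{I\subset\{1,\dots,m\}:\bigcap_{i\in I}F_i\ne\varnothing\}$ (the intersection is taken inside $P$, so $\varnothing\in K_P$), $$U(K_P)=\bigcup_{I\in K_P}\{z\in\mathbb C^m:\ z_j\ne 0\text{ for } j\notin I\},$$ $$Z_P=\{z\in\mathbb C^m:\ \text{there is } u\in P \text{ with } |z_i|^2=\langle a_i,u\rangle+b_i \text{ for all } i\}.$$ Then $Z_P\subset U(K_P)$, and $Z_P$ is the intersection of Hermitian quadrics $$Z_P=\Big\{z\in\mathbb C^m:\ \sum_{k=1}^m\gamma_{jk}|z_k|^2=\sum_{k=1}^m\gamma_{jk}b_k,\ 1\le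 j\le m-n\Big\}$$ for every $(m-n)\times m$ real matrix $(\gamma_{jk})$ whose rows form a basis of the space of linear relations between $a_1,\dots,a_m$. Let $\Psi:\mathbb C^\ell\to\mathbb C^m$ be any $\mathbb C$-linear map such that the composite $\mathrm{Re}\circ\Psi:\mathbb C^\ell\to\mathbb R^m$ is injective and $\sum_i \mathrm{Re}(\Psi(v)_i)\,a_i=0$ for all $v\in\mathbb C^\ell$. Let $C=\{(e^{w_1},\dots,e^{w_m}): w\in\Psi(\mathbb C^\ell)\}\subset(\mathbb C^\times)^m$, acting on $U(K_P)$ by coordinatewise multiplication, and let the torus $\mathbb T^m=\{t\in\mathbb C^m:|t_i|=1\}$ act on $Z_P$ and on $U(K_P)/C$ by coordinatewise multiplication. Then $Z_P$ is a smooth embedded submanifold of $\mathbb C^m$ of real dimension $m+n$; the orbit space $U(K_P)/C$ is Hausdorff and second countable, and carries the structure of a complex manifold of complex dimension $m-\ell$ for which the projection $U(K_P)\to U(K_P)/C$ is a holomorphic submersion; and, for these structures, the composition $$Z_P\hookrightarrow U(K_P)\longrightarrow U(K_P)/C$$ is a $\mathbb T^m$-equivariant diffeomorphism. Consequently $Z_P$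 has the structure of a complex manifold which is compatible with its smooth structure as a submanifold of $\mathbb C^m$ and for which this composition is biholomorphic. -/

import Mathlib

open scoped Manifold ContDiff

noncomputable section

namespace MomentAngle

/-! ### Polytopes given by linear inequalities

`N` is a finite-dimensional real vector space (with an auxiliary norm, all norms being equivalent),
`a i : N` are the normal vectors and `b i : ℝ` the constant terms of `m` affine inequalities on the
dual space of `N`. -/

section Polytope

variable {N : Type*} [NormedAddCommGroup N] [NormedSpace ℝ N] {m : ℕ}

/-- The polyhedron `P = {u ∈ N* : ⟨a i, u⟩ + b i ≥ 0 for all i}`. -/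
def polyhedron (a : Fin m → N) (b : Fin m → ℝ) : Set (StrongDual ℝ N) :=
  {u | ∀ i, 0 ≤ u (a i) + b i}

/-- The intersection `F i` of `P` with the `i`-th hyperplane `⟨a i, u⟩ + b i = 0`. -/
def facet (a : Fin m → N) (b : Fin m → ℝ) (i : Fin m) : Set (StrongDual ℝ N) :=
  {u | u ∈ polyhedron a b ∧ u (a i) + b i = 0}

/-- The inequalities `⟨a i, u⟩ + b i ≥ 0` present a simple polytope `P` of full dimension in `N*`:
* `P` is bounded, nonempty, and of dimension `n = dim N`;
* each `F i` is either empty (redundant inequality) or a facet, i.e. of dimension `n - 1`;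
* exactly `n` facets meet at each vertex. Facets are counted by their indices, so no facet is
  listed twice. -/
structure IsSimplePolytope (a : Fin m → N) (b : Fin m → ℝ) : Prop where
  isBounded : Bornology.IsBounded (polyhedron a b)
  nonempty : (polyhedron a b).Nonempty
  fullDim : Module.finrank ℝ (vectorSpan ℝ (polyhedron a b)) = Module.finrank ℝ N
  facetDim : ∀ i, (facet a b i).Nonempty →
    Module.finrank ℝ (vectorSpan ℝ (facet a b i)) + 1 = Module.finrank ℝ N
  simple : ∀ v ∈ (polyhedron a b).extremePoints ℝ,
    {i | v ∈ facet a b i}.ncard = Module.finrank ℝ N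

/-- The nerve complex `K_P = {I ⊆ [m] : ⋂_{i ∈ I} F i ≠ ∅}`; the intersection is taken inside
`P`, so that `∅ ∈ K_P` as soon as `P` is nonempty. -/
def nerveComplex (a : Fin m → N) (b : Fin m → ℝ) : Set (Finset (Fin m)) :=
  {I | (polyhedron a b ∩ ⋂ i ∈ I, facet a b i).Nonempty}

/-- The space `Z_P ⊆ ℂ^m`: the pullback of `μ : ℂ^m → ℝ^m`, `z ↦ (|z i|²)`, along the affine
embedding `i_P : P → ℝ^m`, `u ↦ (⟨a i, u⟩ + b i)`, viewed as a subset of `ℂ^m`. -/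
def polytopeSpace (a : Fin m → N) (b : Fin m → ℝ) : Set (Fin m → ℂ) :=
  {z | ∃ u ∈ polyhedron a b, ∀ i, u (a i) + b i = ‖z i‖ ^ 2}

end Polytope

/-- The intersection of Hermitian quadrics
`∑ k, γ_{jk} |z k|² = ∑ k, γ_{jk} b k`, one for each row of `Γ = (γ_{jk})`. -/
def hermitianQuadrics {m r : ℕ} (Γ : Matrix (Fin r) (Fin m) ℝ) (b : Fin m → ℝ) :
    Set (Fin m → ℂ) :=
  {z | ∀ j, ∑ k, Γ j k * ‖z k‖ ^ 2 = ∑ k, Γ j k * b k}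

/-! ### The complement `U(K)` of a coordinate subspace arrangement -/

/-- `U(K) = (ℂ, ℂˣ)^K = ⋃_{I ∈ K} {z : z j ≠ 0 for j ∉ I}`, an open subset of `ℂ^m`. -/
def arrangementComplement {m : ℕ} (K : Set (Finset (Fin m))) :
    TopologicalSpace.Opens (Fin m → ℂ) where
  carrier := ⋃ I ∈ K, {z | ∀ j, j ∉ I → z j ≠ 0}
  is_open' := by
    refine isOpen_biUnion fun I _ => ?_
    have h : {z : Fin m → ℂ | ∀ j, j ∉ I → z j ≠ 0} = ⋂ j, ⋂ _ : j ∉ I, {z | z j ≠ 0} := by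
      ext z
      simp
    rw [h]
    refine isOpen_iInter_of_finite fun j => isOpen_iInter_of_finite fun _ => ?_
    exact isOpen_ne_fun (continuous_apply j) continuous_const

lemma mem_arrangementComplement {m : ℕ} {K : Set (Finset (Fin m))} {z : Fin m → ℂ} :
    z ∈ arrangementComplement K ↔ ∃ I ∈ K, ∀ j, j ∉ I → z j ≠ 0 := by
  change z ∈ ⋃ I ∈ K, {z : Fin m → ℂ | ∀ j, j ∉ I → z j ≠ 0} ↔ _
  simp

lemma polytopeSpace_subset {N : Type*} [NormedAddCommGroup N] [NormedSpace ℝ N] {m : ℕ}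
    (a : Fin m → N) (b : Fin m → ℝ) :
    polytopeSpace a b ⊆ arrangementComplement (nerveComplex a b) := by
  classical
  rintro z ⟨u, hu, h⟩
  refine mem_arrangementComplement.2 ⟨Finset.univ.filter fun i => z i = 0,
    ⟨u, hu, ?_⟩, fun j hj => by simpa using hj⟩
  refine Set.mem_iInter₂.2 fun i hi => ⟨hu, ?_⟩
  have hz : z i = 0 := by simpa using hi
  simp [h i, hz]

/-- Coordinatewise multiplication: the action of `(ℂˣ)^m` on `U(K)`. -/
instance {m : ℕ} (K : Set (Finset (Fin m))) :
    MulAction (Fin m → ℂˣ) (arrangementComplement K) where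
  smul t z := ⟨fun i => (t i : ℂ) * z.1 i, by
    obtain ⟨I, hI, h⟩ := mem_arrangementComplement.1 z.2
    exact mem_arrangementComplement.2 ⟨I, hI, fun j hj => mul_ne_zero (t j).ne_zero (h j hj)⟩⟩
  one_smul z := Subtype.ext (funext fun i => one_mul (z.1 i))
  mul_smul s t z := Subtype.ext (funext fun i => mul_assoc (s i : ℂ) (t i : ℂ) (z.1 i))

/-- The inclusion of the torus `T^m` into `(ℂˣ)^m`. -/
def torusToUnits (m : ℕ) : (Fin m → Circle) →* (Fin m → ℂˣ) where
  toFun t i := Circle.toUnits (t i)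
  map_one' := funext fun _ => map_one _
  map_mul' s t := funext fun i => map_mul _ (s i) (t i)

/-- Coordinatewise multiplication: the action of the torus `T^m` on `Z_P`. -/
instance {N : Type*} [NormedAddCommGroup N] [NormedSpace ℝ N] {m : ℕ}
    (a : Fin m → N) (b : Fin m → ℝ) : MulAction (Fin m → Circle) (polytopeSpace a b) where
  smul t z := ⟨fun i => (t i : ℂ) * z.1 i, by
    obtain ⟨u, hu, h⟩ := z.2
    exact ⟨u, hu, fun i => by simp [h i, Circle.norm_coe]⟩⟩
  one_smul z := Subtype.ext (funext fun i => one_mul (z.1 i))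
  mul_smul s t z := Subtype.ext (funext fun i => mul_assoc (s i : ℂ) (t i : ℂ) (z.1 i))

/-! ### The group `C` and the quotient `U(K)/C` -/

/-- The two conditions on a `ℂ`-linear map `Ψ : ℂ^ℓ → ℂ^m`, relative to the vectors `a i ∈ N`:
(a) `Re ∘ Ψ` is injective; (b) `A ∘ Re ∘ Ψ = 0`, where `A : ℝ^m → N` sends `e i` to `a i`. -/
structure IsAdmissible {N : Type*} [NormedAddCommGroup N] [NormedSpace ℝ N] {m ℓ : ℕ}
    (a : Fin m → N) (Ψ : (Fin ℓ → ℂ) →ₗ[ℂ] (Fin m → ℂ)) : Prop where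
  injective_re : Function.Injective fun (v : Fin ℓ → ℂ) (i : Fin m) => (Ψ v i).re
  comp_eq_zero : ∀ v, ∑ i, (Ψ v i).re • a i = 0

/-- The subgroup `C = exp(Ψ(ℂ^ℓ)) = {(e^{w_1}, …, e^{w_m}) : w ∈ Ψ(ℂ^ℓ)}` of `(ℂˣ)^m`. -/
def expSubgroup {m ℓ : ℕ} (Ψ : (Fin ℓ → ℂ) →ₗ[ℂ] (Fin m → ℂ)) : Subgroup (Fin m → ℂˣ) where
  carrier := {t | ∃ w ∈ LinearMap.range Ψ, ∀ i, (t i : ℂ) = Complex.exp (w i)}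
  one_mem' := ⟨0, zero_mem _, fun i => by simp⟩
  mul_mem' := by
    rintro s t ⟨v, hv, hs⟩ ⟨w, hw, ht⟩
    exact ⟨v + w, add_mem hv hw, fun i => by simp [hs i, ht i, Complex.exp_add]⟩
  inv_mem' := by
    rintro t ⟨w, hw, ht⟩
    exact ⟨-w, neg_mem hw, fun i => by simp [ht i, Complex.exp_neg]⟩

/-- The orbit space `U(K)/C`, with the quotient topology. -/
abbrev OrbitSpace {m ℓ : ℕ} (K : Set (Finset (Fin m)))
    (Ψ : (Fin ℓ → ℂ) →ₗ[ℂ] (Fin m → ℂ)) : Type :=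
  Quotient (MulAction.orbitRel (expSubgroup Ψ) (arrangementComplement K))

/-- The projection `U(K) → U(K)/C`. -/
def orbitProj {m ℓ : ℕ} (K : Set (Finset (Fin m))) (Ψ : (Fin ℓ → ℂ) →ₗ[ℂ] (Fin m → ℂ)) :
    arrangementComplement K → OrbitSpace K Ψ :=
  Quotient.mk _

/-- The action of the torus `T^m` on `U(K)/C` induced by coordinatewise multiplication. -/
instance {m ℓ : ℕ} (K : Set (Finset (Fin m))) (Ψ : (Fin ℓ → ℂ) →ₗ[ℂ] (Fin m → ℂ)) :
    MulAction (Fin m → Circle) (OrbitSpace K Ψ) where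
  smul t := Quotient.map (fun z => torusToUnits m t • z) (by
    rintro z w ⟨c, hc⟩
    refine ⟨c, ?_⟩
    change (c : Fin m → ℂˣ) • w = z at hc
    change (c : Fin m → ℂˣ) • (torusToUnits m t • w) = torusToUnits m t • z
    rw [← hc, ← mul_smul, ← mul_smul, mul_comm])
  one_smul x := by
    induction x using Quotient.inductionOn with
    | h z => exact congrArg (Quotient.mk _) (by simp)
  mul_smul s t x := by
    induction x using Quotient.inductionOn with
    | h z => exact congrArg (Quotient.mk _) (by simp [mul_smul])

/-- The composition `Z_P ↪ U(K_P) → U(K_P)/C`. -/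
def toOrbitSpace {N : Type*} [NormedAddCommGroup N] [NormedSpace ℝ N] {m ℓ : ℕ}
    (a : Fin m → N) (b : Fin m → ℝ) (Ψ : (Fin ℓ → ℂ) →ₗ[ℂ] (Fin m → ℂ)) :
    polytopeSpace a b → OrbitSpace (nerveComplex a b) Ψ :=
  fun z => orbitProj (nerveComplex a b) Ψ ⟨z.1, polytopeSpace_subset a b z.2⟩

end MomentAngle

end

open MomentAngle

open scoped Manifold ContDiff Topology

noncomputable section

namespace MomentAngle

/-! ### Faces and vertices of the polytope, and the quadrics defining `Z_P` -/

section PolytopeGeometry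

variable {N : Type*} [NormedAddCommGroup N] [NormedSpace ℝ N] {m : ℕ}
  {a : Fin m → N} {b : Fin m → ℝ}

/-! The point is that every `C`-orbit in `U(K_P)` meets `Z_P` exactly once, and that the flow time
leading there depends smoothly on the starting point. By a dimension count, `Re ∘ Ψ` maps `ℂ^ℓ` onto
the space of linear relations between the `a i` (`IsAdmissible.range_reMap`). Hence `exp(Ψ v) z ∈
Z_P` says precisely that `v` is a critical point of the convex function `v ↦ ∑ i, (‖z i‖² exp(2 Re
Ψ(v)_i) / 2 - b i Re Ψ(v)_i)`, whose differential is `moment`.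

Simplicity makes the normals `a i` with `z i = 0` independent, so no nonzero `v` has `Re Ψ(v)`
supported on the zeros of `z` (`IsAdmissible.eq_zero_of_re_eq_zero`). This gives strict convexity,
hence uniqueness (`moment_injective`), and a definite Hessian (`isInvertible_fderiv_moment`).
Existence (`exists_moment_eq_zero`) comes from coercivity, which uses a point of `P` whose active
constraints are exactly the zeros of `z`. The implicit function theorem then makes the critical
point `ν z` smooth in `z` (`exists_normalization`), and `z ↦ exp(Ψ(ν z)) z` induces the inverse of
`Z_P → U(K_P)/C`.

The complex structure comes from holomorphic slices (`exists_localSlice`): freezing `ℓ` suitable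
nonzero coordinates trivializes the action as base times `ℂ^ℓ`. The base coordinate serves as a
chart of both `Z_P` and the orbit space. Although `ν` is only smooth, it cancels from the transition
maps, which are therefore holomorphic (`contDiffOn_chart_transition`). The pair (base coordinate,
`ν`) is a smooth chart of `ℂ^m` in which `Z_P` is `ν = 0`, which gives the embedding. -/

lemma isClosed_polyhedron (a : Fin m → N) (b : Fin m → ℝ) : IsClosed (polyhedron a b) := by
  have : polyhedron a b = ⋂ i, {u : StrongDual ℝ N | 0 ≤ u (a i) + b i} := by
    ext u; simp [polyhedron]
  rw [this]
  exact isClosed_iInter fun i => isClosed_le continuous_const (by fun_prop)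

lemma mem_facet_iff {u : StrongDual ℝ N} (hu : u ∈ polyhedron a b) {i : Fin m} :
    u ∈ facet a b i ↔ u (a i) + b i = 0 :=
  ⟨fun h => h.2, fun h => ⟨hu, h⟩⟩

/-- A small step in a direction that does not decrease the active constraints stays in the
polyhedron and keeps the inactive constraints inactive. -/
lemma exists_add_smul_mem_polyhedron {u d : StrongDual ℝ N} (hu : u ∈ polyhedron a b)
    (hd : ∀ i, u (a i) + b i = 0 → 0 ≤ d (a i)) :
    ∃ ε : ℝ, 0 < ε ∧ u + ε • d ∈ polyhedron a b ∧
      ∀ i, 0 < u (a i) + b i → 0 < (u + ε • d) (a i) + b i := by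
  have h : ∀ᶠ ε in 𝓝 (0 : ℝ), ∀ i, 0 < u (a i) + b i → 0 < (u + ε • d) (a i) + b i := by
    refine Filter.eventually_all.2 fun i => ?_
    by_cases hi : 0 < u (a i) + b i
    · have hc : ContinuousAt (fun ε : ℝ => (u + ε • d) (a i) + b i) 0 := by
        simp only [add_apply, smul_apply]
        fun_prop
      filter_upwards [hc.eventually_const_lt (by simpa using hi)] with ε hε _ using hε
    · exact Filter.Eventually.of_forall fun _ h => absurd h hi
  obtain ⟨ε, hε, hpos⟩ := ((h.filter_mono nhdsWithin_le_nhds).and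
    (self_mem_nhdsWithin (s := Set.Ioi (0 : ℝ)))).exists
  refine ⟨ε, hpos, fun i => ?_, hε⟩
  rcases (hu i).eq_or_lt with h0 | h0
  · have := hd i h0.symm
    have h1 : (u + ε • d) (a i) + b i = ε * d (a i) := by
      simp only [add_apply, smul_apply, smul_eq_mul]
      linarith
    rw [h1]
    exact mul_nonneg (le_of_lt hpos) this
  · exact (hε i h0).le

/-- Every point of a bounded polyhedron lies on a face containing a vertex. -/
lemma exists_extremePoint_of_mem [FiniteDimensional ℝ N]
    (hb : Bornology.IsBounded (polyhedron a b)) {u : StrongDual ℝ N} (hu : u ∈ polyhedron a b) :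
    ∃ v ∈ (polyhedron a b).extremePoints ℝ, ∀ i, u (a i) + b i = 0 → v (a i) + b i = 0 := by
  have : ProperSpace (StrongDual ℝ N) := FiniteDimensional.proper ℝ _
  set F : Set (StrongDual ℝ N) :=
    {x | x ∈ polyhedron a b ∧ ∀ i, u (a i) + b i = 0 → x (a i) + b i = 0} with hF
  have hFc : IsClosed F := by
    have : F = polyhedron a b ∩ ⋂ i, ⋂ (_ : u (a i) + b i = 0),
        {x : StrongDual ℝ N | x (a i) + b i = 0} := by
      ext x; simp [hF]
    rw [this]
    exact (isClosed_polyhedron a b).inter <| isClosed_iInter fun i => isClosed_iInter fun _ =>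
      isClosed_eq (by fun_prop) continuous_const
  have hcomp : IsCompact F := Metric.isCompact_of_isClosed_isBounded hFc (hb.subset fun x hx => hx.1)
  obtain ⟨v, hv⟩ := hcomp.extremePoints_nonempty ⟨u, hu, fun _ h => h⟩
  -- `F` is a face: a convex combination of nonnegative slacks vanishes only if each term does. So
  -- extreme points of `F` are vertices of the polyhedron.
  have hext : IsExtreme ℝ (polyhedron a b) F := by
    refine ⟨fun x hx => hx.1, ?_⟩
    rintro x hx y hy z hz ⟨s, t, hs, ht, hst, rfl⟩
    refine ⟨hx, fun i hi => ?_⟩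
    have h1 := hz.2 i hi
    simp only [add_apply, smul_apply, smul_eq_mul] at h1
    have h2 : s * (x (a i) + b i) + t * (y (a i) + b i) = 0 := by
      have : (s + t) * b i = b i := by rw [hst, one_mul]
      linarith
    have h3 := mul_nonneg hs.le (hx i)
    have h4 := mul_nonneg ht.le (hy i)
    have h5 : s * (x (a i) + b i) = 0 := by linarith
    exact (mul_eq_zero.1 h5).resolve_left hs.ne'
  exact ⟨v, hext.extremePoints_subset_extremePoints hv, (extremePoints_subset hv).2⟩

/-- The normals of the constraints active at a vertex span the space. -/
lemma span_active_eq_top [FiniteDimensional ℝ N] {v : StrongDual ℝ N}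
    (hv : v ∈ (polyhedron a b).extremePoints ℝ) :
    Submodule.span ℝ (a '' {i | v (a i) + b i = 0}) = ⊤ := by
  by_contra hne
  obtain ⟨f, hf0, hf⟩ := Submodule.exists_le_ker_of_lt_top _ (lt_top_iff_ne_top.2 hne)
  set d : StrongDual ℝ N := LinearMap.toContinuousLinearMap f
  have hd : ∀ i, v (a i) + b i = 0 → d (a i) = 0 := fun i hi =>
    hf (Submodule.subset_span ⟨i, hi, rfl⟩)
  have hvP := extremePoints_subset hv
  -- A functional killing all active normals allows steps in both directions `d` and `-d`, which
  -- puts `v` inside a segment of the polyhedron.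
  obtain ⟨ε, hε, h1, -⟩ := exists_add_smul_mem_polyhedron hvP (d := d) fun i hi => (hd i hi).ge
  obtain ⟨δ, hδ, h2, -⟩ := exists_add_smul_mem_polyhedron hvP (d := -d)
    fun i hi => by simp [hd i hi]
  have hmem : v ∈ openSegment ℝ (v + ε • d) (v + δ • -d) := by
    refine ⟨δ / (ε + δ), ε / (ε + δ), by positivity, by positivity, ?_, ?_⟩
    · field_simp
      ring
    · ext x
      simp only [add_apply, smul_apply,
        neg_apply, smul_eq_mul]
      field_simp
      ring
  have h3 := ((mem_extremePoints.1 hv).2 _ h1 _ h2 hmem).1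
  have h4 : ε • d = 0 := by simpa using h3
  have h5 : d = 0 := (smul_eq_zero.1 h4).resolve_left hε.ne'
  exact hf0 (LinearMap.toContinuousLinearMap.map_eq_zero_iff.1 h5)

lemma top_le_span_range_active [FiniteDimensional ℝ N] {v : StrongDual ℝ N}
    (hv : v ∈ (polyhedron a b).extremePoints ℝ) :
    ⊤ ≤ Submodule.span ℝ (Set.range fun i : {i // v (a i) + b i = 0} => a i) := by
  rw [← span_active_eq_top hv]
  apply Submodule.span_mono
  rintro _ ⟨i, hi, rfl⟩
  exact ⟨⟨i, hi⟩, rfl⟩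

/-- Simplicity is used here: the active normals at a vertex span, and there are exactly `dim N` of
them. -/
lemma linearIndependent_active [FiniteDimensional ℝ N] (hP : IsSimplePolytope a b)
    {v : StrongDual ℝ N} (hv : v ∈ (polyhedron a b).extremePoints ℝ) :
    LinearIndependent ℝ fun i : {i // v (a i) + b i = 0} => a i := by
  classical
  refine linearIndependent_of_top_le_span_of_card_eq_finrank (top_le_span_range_active hv) ?_
  rw [← hP.simple v hv, ← Nat.card_eq_fintype_card]
  simp only [mem_facet_iff (extremePoints_subset hv)]
  rfl

lemma IsSimplePolytope.span_range_eq_top [FiniteDimensional ℝ N] (hP : IsSimplePolytope a b) :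
    Submodule.span ℝ (Set.range a) = ⊤ := by
  obtain ⟨u, hu⟩ := hP.nonempty
  obtain ⟨v, hv, -⟩ := exists_extremePoint_of_mem hP.isBounded hu
  exact top_le_iff.1 (span_active_eq_top hv ▸ Submodule.span_mono (Set.image_subset_range _ _))

/-- Every zero pattern occurring in `U(K_P)` is the set of constraints active at some point of `P`;
the corresponding normals are linearly independent. -/
lemma IsSimplePolytope.exists_active_iff [FiniteDimensional ℝ N] (hP : IsSimplePolytope a b)
    {z : Fin m → ℂ} (hz : z ∈ arrangementComplement (nerveComplex a b)) :
    (∃ u ∈ polyhedron a b, ∀ i, u (a i) + b i = 0 ↔ z i = 0) ∧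
      LinearIndependent ℝ fun i : {i // z i = 0} => a i := by
  classical
  obtain ⟨I, ⟨x, hx, hxI⟩, hI⟩ := mem_arrangementComplement.1 hz
  obtain ⟨v, hv, hxv⟩ := exists_extremePoint_of_mem hP.isBounded hx
  have hvP := extremePoints_subset hv
  have hact : ∀ i, z i = 0 → v (a i) + b i = 0 := fun i hi =>
    hxv i (Set.mem_iInter₂.1 hxI i (by by_contra h; exact hI i h hi)).2
  have hli := linearIndependent_active hP hv
  refine ⟨?_, hli.comp (fun i : {i // z i = 0} => ⟨i.1, hact i.1 i.2⟩)
    fun i j h => Subtype.ext (by simpa using h)⟩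
  set B := Module.Basis.mk hli (top_le_span_range_active hv)
  -- The active normals at the vertex form a basis, so a direction can be prescribed on them: stay
  -- on the facets with `z i = 0` and leave all other active ones.
  set f : N →ₗ[ℝ] ℝ := B.constr ℝ fun i => if z i = 0 then (0 : ℝ) else 1
  have hf : ∀ i, v (a i) + b i = 0 → f (a i) = if z i = 0 then (0 : ℝ) else 1 := by
    intro i hi
    have h := B.constr_basis ℝ (fun i => if z i = 0 then (0 : ℝ) else 1) ⟨i, hi⟩
    rwa [Module.Basis.mk_apply] at h
  obtain ⟨ε, hε, hmem, hpos⟩ := exists_add_smul_mem_polyhedron hvP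
    (d := LinearMap.toContinuousLinearMap f) fun i hi => by
      change 0 ≤ f (a i)
      rw [hf i hi]; split_ifs <;> norm_num
  refine ⟨_, hmem, fun i => ?_⟩
  rcases (hvP i).eq_or_lt with h0 | h0
  · have h1 : (v + ε • LinearMap.toContinuousLinearMap f) (a i) + b i = ε * f (a i) := by
      simp only [add_apply, smul_apply, smul_eq_mul, LinearMap.coe_toContinuousLinearMap']
      linarith
    rw [h1, hf i h0.symm, mul_ite, mul_zero, mul_one, ite_eq_left_iff]
    simp only [hε.ne']
    tauto
  · exact ⟨fun h => absurd h (hpos i h0).ne', fun h => absurd (hact i h) h0.ne'⟩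

/-- A vector annihilates the linear relations between the `a i` iff it is of the form
`(⟨a i, u⟩)`. -/
lemma exists_dual_eq_iff [FiniteDimensional ℝ N] (a : Fin m → N) (d : Fin m → ℝ) :
    (∃ u : StrongDual ℝ N, ∀ i, u (a i) = d i) ↔
      ∀ y ∈ LinearMap.ker (Fintype.linearCombination ℝ a), ∑ i, y i * d i = 0 := by
  constructor
  · rintro ⟨u, hu⟩ y hy
    rw [LinearMap.mem_ker, Fintype.linearCombination_apply] at hy
    have := congrArg u hy
    simpa [hu] using this
  · intro h
    have hmem : Fintype.linearCombination ℝ d ∈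
        (LinearMap.ker (Fintype.linearCombination ℝ a)).dualAnnihilator := by
      rw [Submodule.mem_dualAnnihilator]
      intro y hy
      simpa [Fintype.linearCombination_apply] using h y hy
    rw [← LinearMap.range_dualMap_eq_dualAnnihilator_ker] at hmem
    obtain ⟨g, hg⟩ := hmem
    refine ⟨LinearMap.toContinuousLinearMap g, fun i => ?_⟩
    have := LinearMap.congr_fun hg (Pi.single i 1)
    simpa [Fintype.linearCombination_apply_single] using this

/-- The inequalities defining the polyhedron disappear because the slacks equal `‖z i‖ ^ 2`; only
solvability for `u` remains, which is a condition on linear relations. -/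
lemma mem_polytopeSpace_iff_ker [FiniteDimensional ℝ N] {z : Fin m → ℂ} :
    z ∈ polytopeSpace a b ↔ ∀ y ∈ LinearMap.ker (Fintype.linearCombination ℝ a),
      ∑ i, y i * (‖z i‖ ^ 2 - b i) = 0 := by
  rw [← exists_dual_eq_iff]
  constructor
  · rintro ⟨u, -, h⟩
    exact ⟨u, fun i => by rw [← h i]; ring⟩
  · rintro ⟨u, h⟩
    exact ⟨u, fun i => by rw [h i]; simp, fun i => by rw [h i]; ring⟩

lemma polytopeSpace_eq_hermitianQuadrics [FiniteDimensional ℝ N] {r : ℕ}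
    {Γ : Matrix (Fin r) (Fin m) ℝ}
    (hΓ : Submodule.span ℝ (Set.range Γ.row) = LinearMap.ker (Fintype.linearCombination ℝ a)) :
    polytopeSpace a b = hermitianQuadrics Γ b := by
  ext z
  rw [mem_polytopeSpace_iff_ker, ← hΓ]
  constructor
  · intro h j
    have := h _ (Submodule.subset_span ⟨j, rfl⟩)
    simp only [Matrix.row_def, mul_sub, Finset.sum_sub_distrib] at this
    linarith
  · intro h y hy
    induction hy using Submodule.span_induction with
    | mem y hy =>
      obtain ⟨j, rfl⟩ := hy
      have := h j
      simp only [Matrix.row_def, mul_sub, Finset.sum_sub_distrib]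
      linarith
    | zero => simp
    | add x y _ _ hx hy => simp [add_mul, Finset.sum_add_distrib, hx, hy]
    | smul c x _ hx => simp [mul_assoc, ← Finset.mul_sum, hx]

end PolytopeGeometry

/-! ### The action of `ℂ^ℓ` through `exp ∘ Ψ` -/

section Flow

variable {m ℓ : ℕ} (Ψ : (Fin ℓ → ℂ) →ₗ[ℂ] (Fin m → ℂ))

/-- The action of `v ∈ ℂ^ℓ` on `ℂ^m` through `exp(Ψ v)`. -/
def expFlow (v : Fin ℓ → ℂ) (z : Fin m → ℂ) : Fin m → ℂ :=
  fun i => Complex.exp (Ψ v i) * z i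

variable {Ψ}

@[simp] lemma expFlow_zero (z : Fin m → ℂ) : expFlow Ψ 0 z = z := by
  ext i; simp [expFlow]

lemma expFlow_expFlow (v w : Fin ℓ → ℂ) (z : Fin m → ℂ) :
    expFlow Ψ v (expFlow Ψ w z) = expFlow Ψ (v + w) z := by
  ext i; simp [expFlow, Complex.exp_add, mul_assoc]

@[simp] lemma expFlow_neg_expFlow (v : Fin ℓ → ℂ) (z : Fin m → ℂ) :
    expFlow Ψ (-v) (expFlow Ψ v z) = z := by
  simp [expFlow_expFlow]

@[simp] lemma expFlow_expFlow_neg (v : Fin ℓ → ℂ) (z : Fin m → ℂ) :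
    expFlow Ψ v (expFlow Ψ (-v) z) = z := by
  simp [expFlow_expFlow]

lemma expFlow_eq_zero_iff {v : Fin ℓ → ℂ} {z : Fin m → ℂ} {i : Fin m} :
    expFlow Ψ v z i = 0 ↔ z i = 0 := by
  simp [expFlow]

lemma expFlow_mem_arrangementComplement {K : Set (Finset (Fin m))} {z : Fin m → ℂ}
    (hz : z ∈ arrangementComplement K) (v : Fin ℓ → ℂ) :
    expFlow Ψ v z ∈ arrangementComplement K := by
  obtain ⟨I, hI, h⟩ := mem_arrangementComplement.1 hz
  exact mem_arrangementComplement.2 ⟨I, hI, fun j hj => by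
    rw [Ne, expFlow_eq_zero_iff]; exact h j hj⟩

lemma norm_expFlow_sq (v : Fin ℓ → ℂ) (z : Fin m → ℂ) (i : Fin m) :
    ‖expFlow Ψ v z i‖ ^ 2 = ‖z i‖ ^ 2 * Real.exp (2 * (Ψ v i).re) := by
  rw [expFlow, norm_mul, Complex.norm_exp, mul_pow, ← Real.exp_nat_mul]
  push_cast
  ring

lemma contDiff_linearMap_apply {n : WithTop ℕ∞} :
    ContDiff ℂ n fun v : Fin ℓ → ℂ => Ψ v :=
  (LinearMap.toContinuousLinearMap Ψ).contDiff

lemma contDiff_expFlow {n : WithTop ℕ∞} :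
    ContDiff ℂ n fun p : (Fin ℓ → ℂ) × (Fin m → ℂ) => expFlow Ψ p.1 p.2 := by
  refine contDiff_pi.2 fun i => ?_
  have h1 : ContDiff ℂ n fun p : (Fin ℓ → ℂ) × (Fin m → ℂ) => Ψ p.1 i :=
    (contDiff_pi.1 (contDiff_linearMap_apply (Ψ := Ψ)) i).comp contDiff_fst
  have h2 : ContDiff ℂ n fun p : (Fin ℓ → ℂ) × (Fin m → ℂ) => p.2 i :=
    (contDiff_apply ℂ ℂ i).comp contDiff_snd
  exact h1.cexp.mul h2

end Flow

/-! ### Each orbit meets `Z_P` once: convexity and the implicit function theorem -/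

section Normalization

variable {N : Type*} [NormedAddCommGroup N] [NormedSpace ℝ N]
  {n m ℓ : ℕ} {a : Fin m → N} {b : Fin m → ℝ} {Ψ : (Fin ℓ → ℂ) →ₗ[ℂ] (Fin m → ℂ)}

/-- The real linear map `Re ∘ Ψ : ℂ^ℓ → ℝ^m`. -/
def reMap (Ψ : (Fin ℓ → ℂ) →ₗ[ℂ] (Fin m → ℂ)) : (Fin ℓ → ℂ) →L[ℝ] (Fin m → ℝ) :=
  LinearMap.toContinuousLinearMap
    ((LinearMap.pi fun i => Complex.reLm ∘ₗ LinearMap.proj i) ∘ₗ Ψ.restrictScalars ℝ)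

@[simp] lemma reMap_apply (v : Fin ℓ → ℂ) (i : Fin m) : reMap Ψ v i = (Ψ v i).re := rfl

/-- Both sides have real dimension `2ℓ = m - n`: the range by injectivity, the kernel because the `a
i` span `N`. -/
lemma IsAdmissible.range_reMap [FiniteDimensional ℝ N] (hΨ : IsAdmissible a Ψ)
    (hn : Module.finrank ℝ N = n) (hm : m = n + 2 * ℓ) (hP : IsSimplePolytope a b) :
    LinearMap.range (reMap Ψ : (Fin ℓ → ℂ) →ₗ[ℝ] (Fin m → ℝ)) =
      LinearMap.ker (Fintype.linearCombination ℝ a) := by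
  refine Submodule.eq_of_le_of_finrank_eq ?_ ?_
  · rintro _ ⟨v, rfl⟩
    rw [LinearMap.mem_ker, Fintype.linearCombination_apply]
    exact hΨ.comp_eq_zero v
  · have h1 : Module.finrank ℝ (LinearMap.range (reMap Ψ : (Fin ℓ → ℂ) →ₗ[ℝ] (Fin m → ℝ))) =
        2 * ℓ := by
      rw [LinearMap.finrank_range_of_inj hΨ.injective_re, Module.finrank_pi_fintype]
      simp [Complex.finrank_real_complex, mul_comm]
    have h2 := LinearMap.finrank_range_add_finrank_ker (Fintype.linearCombination ℝ a)
    rw [Fintype.range_linearCombination, hP.span_range_eq_top, finrank_top, hn] at h2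
    simp only [Module.finrank_fintype_fun_eq_card, Fintype.card_fin] at h2
    omega

/-- What remains of `Re Ψ(v)` is a relation between the normals with `z i = 0`, which are
independent. This nondegeneracy underlies uniqueness, coercivity, the definite Hessian and the
choice of slices. -/
lemma IsAdmissible.eq_zero_of_re_eq_zero [FiniteDimensional ℝ N] (hΨ : IsAdmissible a Ψ)
    (hP : IsSimplePolytope a b) {z : Fin m → ℂ}
    (hz : z ∈ arrangementComplement (nerveComplex a b)) {v : Fin ℓ → ℂ}
    (hv : ∀ i, z i ≠ 0 → (Ψ v i).re = 0) : v = 0 := by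
  classical
  have hli := (hP.exists_active_iff hz).2
  have hsum : ∑ i : {i // z i = 0}, (Ψ v i).re • a i = 0 := by
    rw [← hΨ.comp_eq_zero v]
    refine (Finset.sum_subtype (Finset.univ.filter fun i => z i = 0) (by simp)
      fun i => (Ψ v i).re • a i).symm.trans ?_
    rw [Finset.sum_filter]
    refine Finset.sum_congr rfl fun i _ => ?_
    split_ifs with h
    · rfl
    · simp [hv i h]
  have h0 := Fintype.linearIndependent_iff.1 hli _ hsum
  apply hΨ.injective_re
  ext i
  by_cases h : z i = 0
  · simpa using h0 ⟨i, h⟩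
  · simpa using hv i h

/-- The differential in `v` of the function whose critical points are the `v` that move `z` into
`Z_P`. -/
def moment (b : Fin m → ℝ) (Ψ : (Fin ℓ → ℂ) →ₗ[ℂ] (Fin m → ℂ))
    (p : (Fin m → ℂ) × (Fin ℓ → ℂ)) : (Fin ℓ → ℂ) →L[ℝ] ℝ :=
  ∑ i, (‖p.1 i‖ ^ 2 * Real.exp (2 * reMap Ψ p.2 i) - b i) •
    (ContinuousLinearMap.proj (R := ℝ) (φ := fun _ : Fin m => ℝ) i ∘L reMap Ψ)

lemma moment_apply (z : Fin m → ℂ) (v w : Fin ℓ → ℂ) :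
    moment b Ψ (z, v) w =
      ∑ i, (‖z i‖ ^ 2 * Real.exp (2 * (Ψ v i).re) - b i) * (Ψ w i).re := by
  simp [moment]

lemma contDiff_moment : ContDiff ℝ ∞ (moment b Ψ) := by
  refine ContDiff.sum fun i _ => ContDiff.fun_smul (ContDiff.sub (ContDiff.mul ?_ ?_) contDiff_const)
    contDiff_const
  · exact ((contDiff_apply ℝ ℂ i).comp contDiff_fst).norm_sq ℝ
  · refine (contDiff_const.mul ?_).exp
    exact (contDiff_apply ℝ ℝ i).comp ((reMap Ψ).contDiff.comp contDiff_snd)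

lemma expFlow_mem_polytopeSpace_iff [FiniteDimensional ℝ N] (hΨ : IsAdmissible a Ψ)
    (hn : Module.finrank ℝ N = n) (hm : m = n + 2 * ℓ) (hP : IsSimplePolytope a b)
    {z : Fin m → ℂ} {v : Fin ℓ → ℂ} :
    expFlow Ψ v z ∈ polytopeSpace a b ↔ moment b Ψ (z, v) = 0 := by
  rw [mem_polytopeSpace_iff_ker, ← hΨ.range_reMap hn hm hP]
  constructor
  · intro h
    ext w
    rw [moment_apply]
    simpa [norm_expFlow_sq, mul_comm] using h _ ⟨w, rfl⟩
  · rintro h _ ⟨w, rfl⟩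
    have := DFunLike.congr_fun h w
    rw [moment_apply] at this
    simpa [norm_expFlow_sq, mul_comm] using this

/-- The gradient of a strictly convex function is injective. Pairing the difference of the two
gradients with `v - w` gives a sum of nonnegative terms, so each term vanishes. -/
lemma moment_injective [FiniteDimensional ℝ N] (hΨ : IsAdmissible a Ψ)
    (hP : IsSimplePolytope a b) {z : Fin m → ℂ}
    (hz : z ∈ arrangementComplement (nerveComplex a b)) {v w : Fin ℓ → ℂ}
    (h : moment b Ψ (z, v) = moment b Ψ (z, w)) : v = w := by
  have h1 := DFunLike.congr_fun h (v - w)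
  rw [moment_apply, moment_apply, ← sub_eq_zero, ← Finset.sum_sub_distrib] at h1
  have h2 : ∀ i, ((‖z i‖ ^ 2 * Real.exp (2 * (Ψ v i).re) - b i) * (Ψ (v - w) i).re -
      (‖z i‖ ^ 2 * Real.exp (2 * (Ψ w i).re) - b i) * (Ψ (v - w) i).re) =
      ‖z i‖ ^ 2 * ((Real.exp (2 * (Ψ v i).re) - Real.exp (2 * (Ψ w i).re)) *
        ((Ψ v i).re - (Ψ w i).re)) := fun i => by
    rw [map_sub, Pi.sub_apply, Complex.sub_re]; ring
  have hmono : ∀ s t : ℝ, 0 ≤ (Real.exp (2 * s) - Real.exp (2 * t)) * (s - t) := fun s t => by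
    rcases le_total s t with hst | hst
    · exact mul_nonneg_of_nonpos_of_nonpos
        (sub_nonpos.2 (Real.exp_le_exp.2 (by linarith))) (sub_nonpos.2 hst)
    · exact mul_nonneg (sub_nonneg.2 (Real.exp_le_exp.2 (by linarith))) (sub_nonneg.2 hst)
  simp only [h2] at h1
  rw [Finset.sum_eq_zero_iff_of_nonneg fun i _ => mul_nonneg (sq_nonneg _) (hmono _ _)] at h1
  rw [← sub_eq_zero]
  refine hΨ.eq_zero_of_re_eq_zero hP hz fun i hi => ?_
  have h3 := (mul_eq_zero.1 (h1 i (Finset.mem_univ i))).resolve_left (by simpa using hi)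
  rw [map_sub, Pi.sub_apply, Complex.sub_re]
  rcases mul_eq_zero.1 h3 with h4 | h4
  · have := Real.exp_injective (sub_eq_zero.1 h4)
    linarith
  · exact h4

/-- Coercivity in one variable. For `t ≤ 0` the linear term suffices; for `t ≥ 0` the exponential is
bounded below by its tangent line of slope `4p`, touching where `exp (2t) = 2p / c`. -/
lemma exists_mul_exp_sub_ge {c p : ℝ} (hc : 0 ≤ c) (hp : 0 ≤ p) (h : p = 0 ↔ c = 0) :
    ∃ D : ℝ, ∀ t : ℝ, 2 * (p * |t|) - D ≤ c * Real.exp (2 * t) - 2 * p * t := by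
  rcases hc.eq_or_lt with h0 | h0
  · have hp0 := h.2 h0.symm
    exact ⟨0, fun t => by simp [← h0, hp0]⟩
  have hp0 : 0 < p := hp.lt_of_ne fun hp' => h0.ne (h.1 hp'.symm).symm
  refine ⟨|2 * p * (1 - Real.log (2 * p / c))|, fun t => ?_⟩
  rcases le_total t 0 with ht | ht
  · rw [abs_of_nonpos ht]
    have := mul_pos h0 (Real.exp_pos (2 * t))
    have := abs_nonneg (2 * p * (1 - Real.log (2 * p / c)))
    linarith
  · rw [abs_of_nonneg ht]
    have hK : 0 < 2 * p / c := by positivity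
    have h1 := Real.add_one_le_exp (2 * t - Real.log (2 * p / c))
    rw [Real.exp_sub, Real.exp_log hK, le_div_iff₀ hK] at h1
    have h2 := mul_le_mul_of_nonneg_left h1 h0.le
    have h3 : c * ((2 * t - Real.log (2 * p / c) + 1) * (2 * p / c)) =
        2 * p * (1 - Real.log (2 * p / c)) + 4 * p * t := by
      field_simp
      ring
    have := neg_abs_le (2 * p * (1 - Real.log (2 * p / c)))
    linarith

/-- A minimum of a coercive function is a critical point. Replacing `b i` by the slack `p i = u (a
i) + b i` leaves the differential unchanged, since `∑ u (a i) Re Ψ(w)_i = 0`, but it makes the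
linear coefficients nonnegative with the same zeros as `z`, as coercivity requires. -/
lemma exists_moment_eq_zero [FiniteDimensional ℝ N] (hΨ : IsAdmissible a Ψ)
    (hP : IsSimplePolytope a b) {z : Fin m → ℂ}
    (hz : z ∈ arrangementComplement (nerveComplex a b)) :
    ∃ v, moment b Ψ (z, v) = 0 := by
  obtain ⟨u, hu, huz⟩ := (hP.exists_active_iff hz).1
  set p : Fin m → ℝ := fun i => u (a i) + b i with hp
  set f : (Fin ℓ → ℂ) → ℝ := fun v =>
    ∑ i, (‖z i‖ ^ 2 * Real.exp (2 * reMap Ψ v i) - 2 * p i * reMap Ψ v i) with hf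
  have hfc : Continuous f := by
    refine continuous_finsetSum _ fun i _ => ?_
    have : Continuous fun v => reMap Ψ v i := (continuous_apply i).comp (reMap Ψ).continuous
    fun_prop
  choose D hD using fun i => exists_mul_exp_sub_ge (c := ‖z i‖ ^ 2) (p := p i) (sq_nonneg _) (hu i)
    (by simpa using huz i)
  set M : (Fin ℓ → ℂ) →ₗ[ℝ] (Fin m → ℝ) :=
    (LinearMap.pi fun i => p i • LinearMap.proj i) ∘ₗ (reMap Ψ : (Fin ℓ → ℂ) →ₗ[ℝ] (Fin m → ℝ))
  have hM : ∀ v i, M v i = p i * reMap Ψ v i := fun v i => rfl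
  have hMinj : LinearMap.ker M = ⊥ := by
    rw [LinearMap.ker_eq_bot']
    intro v hv
    refine hΨ.eq_zero_of_re_eq_zero hP hz fun i hi => ?_
    have := congrFun hv i
    rw [hM] at this
    exact (mul_eq_zero.1 this).resolve_left fun h => hi ((huz i).1 h)
  have hfM : ∀ v, 2 * ‖M v‖ - ∑ i, D i ≤ f v := by
    intro v
    have h1 : ‖M v‖ ≤ ∑ i, p i * |reMap Ψ v i| := by
      refine (pi_norm_le_iff_of_nonneg
        (Finset.sum_nonneg fun i _ => mul_nonneg (hu i) (abs_nonneg _))).2 fun i => ?_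
      rw [hM, Real.norm_eq_abs, abs_mul, abs_of_nonneg (hu i)]
      exact Finset.single_le_sum (f := fun i => p i * |reMap Ψ v i|)
        (fun i _ => mul_nonneg (hu i) (abs_nonneg _)) (Finset.mem_univ i)
    have h2 : ∑ i, (2 * (p i * |reMap Ψ v i|) - D i) ≤ f v :=
      Finset.sum_le_sum fun i _ => hD i _
    rw [Finset.sum_sub_distrib, ← Finset.mul_sum] at h2
    linarith
  have hlim : Filter.Tendsto f (Filter.cocompact _) Filter.atTop := by
    refine Filter.tendsto_atTop_mono hfM ?_
    have h1 := (tendsto_norm_cocompact_atTop (E := Fin m → ℝ)).comp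
      (LinearMap.isClosedEmbedding_of_injective hMinj).tendsto_cocompact
    exact Filter.tendsto_atTop_add_const_right _ _ (h1.const_mul_atTop two_pos)
  obtain ⟨v, hv⟩ := hfc.exists_forall_le hlim
  refine ⟨v, ?_⟩
  ext w
  have hmin : IsLocalMin (fun s : ℝ => f (v + s • w)) 0 :=
    Filter.Eventually.of_forall fun s => by simpa using hv (v + s • w)
  have hderiv : HasDerivAt (fun s : ℝ => f (v + s • w))
      (∑ i, (‖z i‖ ^ 2 * (Real.exp (2 * reMap Ψ v i) * (2 * reMap Ψ w i)) -
        2 * p i * reMap Ψ w i)) 0 := by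
    refine HasDerivAt.fun_sum fun i _ => ?_
    have h1 : HasDerivAt (fun s : ℝ => reMap Ψ (v + s • w) i) (reMap Ψ w i) 0 := by
      have : (fun s : ℝ => reMap Ψ (v + s • w) i) = fun s => reMap Ψ v i + s * reMap Ψ w i := by
        ext s
        rw [map_add, map_smul]
        rfl
      rw [this]
      simpa using ((hasDerivAt_id (0 : ℝ)).mul_const (reMap Ψ w i)).const_add (reMap Ψ v i)
    have h2 := ((h1.const_mul 2).exp.const_mul (‖z i‖ ^ 2)).fun_sub (h1.const_mul (2 * p i))
    simpa using h2
  have h0 := hmin.hasDerivAt_eq_zero hderiv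
  have h3 : ∑ i, u (a i) * reMap Ψ w i = 0 := by
    have := congrArg u (hΨ.comp_eq_zero w)
    simpa [mul_comm] using this
  have h4 : 2 * moment b Ψ (z, v) w = ∑ i, (‖z i‖ ^ 2 * (Real.exp (2 * reMap Ψ v i) *
      (2 * reMap Ψ w i)) - 2 * p i * reMap Ψ w i) + 2 * ∑ i, u (a i) * reMap Ψ w i := by
    rw [moment_apply, Finset.mul_sum, Finset.mul_sum, ← Finset.sum_add_distrib]
    refine Finset.sum_congr rfl fun i _ => ?_
    simp only [hp, reMap_apply]
    ring
  rw [h0, h3] at h4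
  simpa using h4

/-- The partial derivative in `v` is a Hessian with quadratic form `2 ∑ ‖z i‖² exp(2 Re Ψ(v)_i) (Re
Ψ(w)_i)²`. It is positive definite, hence injective, hence bijective by dimension. -/
lemma isInvertible_fderiv_moment [FiniteDimensional ℝ N] (hΨ : IsAdmissible a Ψ)
    (hP : IsSimplePolytope a b) {z : Fin m → ℂ}
    (hz : z ∈ arrangementComplement (nerveComplex a b)) (v : Fin ℓ → ℂ) :
    (fderiv ℝ (moment b Ψ) (z, v) ∘L .inr ℝ (Fin m → ℂ) (Fin ℓ → ℂ)).IsInvertible := by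
  set A := fderiv ℝ (moment b Ψ) (z, v) ∘L .inr ℝ (Fin m → ℂ) (Fin ℓ → ℂ) with hA
  have hAw : ∀ w, A w w = ∑ i, ‖z i‖ ^ 2 * (Real.exp (2 * (Ψ v i).re) * (2 * (Ψ w i).re)) *
      (Ψ w i).re := by
    intro w
    have h1 : HasDerivAt (fun s : ℝ => moment b Ψ (z, v + s • w)) (A w) 0 := by
      have hF : HasFDerivAt (moment b Ψ) (fderiv ℝ (moment b Ψ) (z, v)) (z, v + (0 : ℝ) • w) := by
        rw [zero_smul, add_zero]
        exact (contDiff_moment.differentiable (by simp)).differentiableAt.hasFDerivAt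
      have hc : HasDerivAt (fun s : ℝ => (z, v + s • w)) ((0 : Fin m → ℂ), w) 0 := by
        refine (hasDerivAt_const _ _).prodMk ?_
        simpa using ((hasDerivAt_id (0 : ℝ)).smul_const w).const_add v
      exact hF.comp_hasDerivAt 0 hc
    have h2 : HasDerivAt (fun s : ℝ => moment b Ψ (z, v + s • w) w) (A w w) 0 :=
      (ContinuousLinearMap.apply ℝ ℝ w).hasFDerivAt.comp_hasDerivAt 0 h1
    refine h2.unique ?_
    simp only [moment_apply]
    refine HasDerivAt.fun_sum fun i _ => HasDerivAt.mul_const ?_ _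
    refine HasDerivAt.sub_const _ (HasDerivAt.const_mul (‖z i‖ ^ 2) ?_)
    have h3 : HasDerivAt (fun s : ℝ => (Ψ (v + s • w) i).re) (Ψ w i).re 0 := by
      have : (fun s : ℝ => (Ψ (v + s • w) i).re) = fun s => (Ψ v i).re + s * (Ψ w i).re := by
        ext s
        simp
      rw [this]
      simpa using ((hasDerivAt_id (0 : ℝ)).mul_const (Ψ w i).re).const_add (Ψ v i).re
    simpa using (h3.const_mul 2).exp
  have hinj : Function.Injective (A : (Fin ℓ → ℂ) →ₗ[ℝ] ((Fin ℓ → ℂ) →L[ℝ] ℝ)) := by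
    rw [← LinearMap.ker_eq_bot, LinearMap.ker_eq_bot']
    intro w hw
    have h1 : A w w = 0 := by
      have : A w = 0 := hw
      rw [this]; rfl
    rw [hAw, Finset.sum_eq_zero_iff_of_nonneg] at h1
    · refine hΨ.eq_zero_of_re_eq_zero hP hz fun i hi => ?_
      simpa [hi] using h1 i (Finset.mem_univ i)
    · intro i _
      have : ‖z i‖ ^ 2 * (Real.exp (2 * (Ψ v i).re) * (2 * (Ψ w i).re)) * (Ψ w i).re =
        2 * ‖z i‖ ^ 2 * Real.exp (2 * (Ψ v i).re) * (Ψ w i).re ^ 2 := by ring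
      rw [this]
      positivity
  have hrank : Module.finrank ℝ (Fin ℓ → ℂ) = Module.finrank ℝ ((Fin ℓ → ℂ) →L[ℝ] ℝ) := by
    rw [← (LinearMap.toContinuousLinearMap (𝕜 := ℝ) (E := Fin ℓ → ℂ) (F' := ℝ)).finrank_eq]
    exact (Subspace.dual_finrank_eq (K := ℝ) (V := Fin ℓ → ℂ)).symm
  exact ⟨(LinearEquiv.ofInjectiveOfFinrankEq _ hinj hrank).toContinuousLinearEquiv, by ext; rfl⟩

/-- The normalization `ν : U(K_P) → ℂ^ℓ`: `ν z` is the unique `v` for which `exp(Ψ v) z ∈ Z_P`. -/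
lemma exists_normalization [FiniteDimensional ℝ N] (hΨ : IsAdmissible a Ψ)
    (hn : Module.finrank ℝ N = n) (hm : m = n + 2 * ℓ) (hP : IsSimplePolytope a b) :
    ∃ ν : (Fin m → ℂ) → (Fin ℓ → ℂ),
      (∀ z ∈ arrangementComplement (nerveComplex a b), ∀ v,
        expFlow Ψ v z ∈ polytopeSpace a b ↔ ν z = v) ∧
      ContDiffOn ℝ ∞ ν (arrangementComplement (nerveComplex a b)) := by
  classical
  choose! ν hν using fun (z : Fin m → ℂ)
    (hz : z ∈ arrangementComplement (nerveComplex a b)) => exists_moment_eq_zero hΨ hP hz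
  refine ⟨ν, fun z hz v => ?_, fun z hz => ContDiffAt.contDiffWithinAt ?_⟩
  · rw [expFlow_mem_polytopeSpace_iff hΨ hn hm hP]
    exact ⟨fun h => moment_injective hΨ hP hz ((hν z hz).trans h.symm), fun h => h ▸ hν z hz⟩
  · have hcd : ContDiffAt ℝ ∞ (moment b Ψ) (z, ν z) := contDiff_moment.contDiffAt
    have hinv := isInvertible_fderiv_moment hΨ hP hz (ν z)
    -- The implicit function solves the same equation near `z`, so by uniqueness of solutions it
    -- coincides with `ν`.
    refine (hcd.contDiffAt_implicitFunction (by simp) hinv).congr_of_eventuallyEq ?_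
    filter_upwards [hcd.eventually_apply_implicitFunction (by simp) hinv,
      (arrangementComplement (nerveComplex a b)).isOpen.mem_nhds hz] with x hx hxU
    exact moment_injective hΨ hP hxU ((hν x hxU).trans ((hν z hz).symm.trans hx.symm))

end Normalization

/-! ### Holomorphic slices for the action -/

/-- An injective continuous map with `C^n` local right inverses is an open partial homeomorphism
with `C^n` inverse. -/
lemma exists_openPartialHomeomorph_of_rightInverse {𝕜 X Y : Type*} [NontriviallyNormedField 𝕜]
    [NormedAddCommGroup X] [NormedSpace 𝕜 X] [NormedAddCommGroup Y] [NormedSpace 𝕜 Y]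
    {k : WithTop ℕ∞} {f : X → Y} {S : Set X} (hS : IsOpen S) (hinj : Set.InjOn f S)
    (hf : ContinuousOn f S)
    (h : ∀ p ∈ S, ∃ g : Y → X, ContDiffAt 𝕜 k g (f p) ∧ g (f p) = p ∧
      ∀ᶠ y in 𝓝 (f p), f (g y) = y) :
    ∃ T : OpenPartialHomeomorph X Y, T.source = S ∧ ⇑T = f ∧ ContDiffOn 𝕜 k T.symm T.target := by
  set e : PartialEquiv X Y := hinj.toPartialEquiv f S with he
  have key : ∀ p ∈ S, f '' S ∈ 𝓝 (f p) ∧ ContDiffAt 𝕜 k e.symm (f p) := by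
    intro p hp
    obtain ⟨g, hg, hgp, hfg⟩ := h p hp
    have hgS : ∀ᶠ y in 𝓝 (f p), g y ∈ S :=
      hg.continuousAt.eventually_mem (by rw [hgp]; exact hS.mem_nhds hp)
    refine ⟨?_, hg.congr_of_eventuallyEq ?_⟩
    · filter_upwards [hfg, hgS] with y h1 h2 using ⟨g y, h2, h1⟩
    · filter_upwards [hfg, hgS] with y h1 h2
      have := e.left_inv (x := g y) h2
      rwa [show e (g y) = y from h1] at this
  refine ⟨{ toPartialEquiv := e
            open_source := hS
            open_target := ?_
            continuousOn_toFun := hf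
            continuousOn_invFun := ?_ }, rfl, rfl, ?_⟩
  · rintro _ ⟨p, hp, rfl⟩
    exact (key p hp).2.continuousAt.continuousWithinAt
  · rw [isOpen_iff_mem_nhds]
    rintro _ ⟨p, hp, rfl⟩
    exact (key p hp).1
  · rintro _ ⟨p, hp, rfl⟩
    exact (key p hp).2.contDiffWithinAt

section Slice

variable {m ℓ : ℕ}

/-- A holomorphic trivialization of the action of `ℂ^ℓ` on an invariant open subset of `U(K)`. -/
structure LocalSlice (K : Set (Finset (Fin m))) (Ψ : (Fin ℓ → ℂ) →ₗ[ℂ] (Fin m → ℂ)) (E : Type*)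
    [NormedAddCommGroup E] [NormedSpace ℂ E] where
  /-- The trivialization. -/
  triv : OpenPartialHomeomorph (Fin m → ℂ) (E × (Fin ℓ → ℂ))
  /-- The parameter space of the slice. -/
  base : Set E
  isOpen_base : IsOpen base
  target_eq : triv.target = base ×ˢ Set.univ
  source_subset : triv.source ⊆ arrangementComplement K
  symm_apply : ∀ x v, triv.symm (x, v) = expFlow Ψ v (triv.symm (x, 0))
  contDiffOn : ContDiffOn ℂ ω triv triv.source
  contDiffOn_symm : ContDiffOn ℂ ω triv.symm triv.target

/-- `ℓ` coordinates which do not vanish at a point of `U(K_P)` and separate the points of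
`Ψ(ℂ^ℓ)`. -/
lemma exists_separating_coordinates {n : ℕ} {Ψ : (Fin ℓ → ℂ) →ₗ[ℂ] (Fin m → ℂ)}
    (hm : m = n + 2 * ℓ) {z : Fin m → ℂ}
    (h : ∀ v : Fin ℓ → ℂ, (∀ i, z i ≠ 0 → Ψ v i = 0) → v = 0) :
    ∃ e : Fin (n + ℓ) ⊕ Fin ℓ ≃ Fin m, (∀ j, z (e (Sum.inr j)) ≠ 0) ∧
      Function.Injective fun (v : Fin ℓ → ℂ) (j : Fin ℓ) => Ψ v (e (Sum.inr j)) := by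
  classical
  -- Among the functionals `v ↦ Ψ v i` with `z i ≠ 0`, which have no common zero except `0`, a
  -- maximal independent family has exactly `ℓ` members and still separates points.
  obtain ⟨κ, α, hα, hspan, hli⟩ := exists_linearIndependent' ℂ
    fun i : {i // z i ≠ 0} => (LinearMap.proj i.1 ∘ₗ Ψ : Module.Dual ℂ (Fin ℓ → ℂ))
  have : Finite κ := Finite.of_injective α hα
  have : Fintype κ := Fintype.ofFinite κ
  set G : (Fin ℓ → ℂ) →ₗ[ℂ] (κ → ℂ) := LinearMap.pi fun k => LinearMap.proj (α k).1 ∘ₗ Ψ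
  have hG : ∀ v, G v = 0 → v = 0 := by
    intro v hv
    refine h v fun i hi => ?_
    have hle : Submodule.span ℂ (Set.range fun i : {i // z i ≠ 0} =>
        (LinearMap.proj i.1 ∘ₗ Ψ : Module.Dual ℂ (Fin ℓ → ℂ))) ≤
        LinearMap.ker (Module.Dual.eval ℂ (Fin ℓ → ℂ) v) := by
      rw [← hspan, Submodule.span_le]
      rintro _ ⟨k, rfl⟩
      exact congrFun hv k
    exact hle (Submodule.subset_span ⟨⟨i, hi⟩, rfl⟩)
  have hcard : Fintype.card κ = ℓ := by
    apply le_antisymm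
    · simpa [Subspace.dual_finrank_eq] using hli.fintype_card_le_finrank
    · simpa using LinearMap.finrank_le_finrank_of_injective
        (LinearMap.ker_eq_bot.1 (LinearMap.ker_eq_bot'.2 hG))
  set τ : Fin ℓ ≃ κ := (Fintype.equivFinOfCardEq hcard).symm
  have hinj : Function.Injective fun j => (α (τ j)).1 :=
    Subtype.val_injective.comp (hα.comp τ.injective)
  set R : Set (Fin m) := Set.range fun j => (α (τ j)).1
  have hR : Fintype.card (Rᶜ : Set (Fin m)) = n + ℓ := by
    rw [Fintype.card_compl_set, Set.card_range_of_injective hinj]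
    simp only [Fintype.card_fin]
    omega
  refine ⟨(Equiv.sumComm _ _).trans ((Equiv.sumCongr (Equiv.ofInjective _ hinj)
    (Fintype.equivFinOfCardEq hR).symm).trans (Equiv.Set.sumCompl R)), fun j => (α (τ j)).2, ?_⟩
  intro v w hvw
  rw [← sub_eq_zero]
  refine hG _ (funext fun k => ?_)
  have := congrFun hvw (τ.symm k)
  rw [map_sub]
  simpa [sub_eq_zero, G] using this

end Slice

section Existence

variable {m ℓ k : ℕ} {K : Set (Finset (Fin m))} {Ψ : (Fin ℓ → ℂ) →ₗ[ℂ] (Fin m → ℂ)}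

/-- The affine slice on which the coordinates indexed by `e (inr j)` are constant. -/
def coordSlice (e : Fin k ⊕ Fin ℓ ≃ Fin m) (c : Fin ℓ → ℂ) (x : Fin k → ℂ) : Fin m → ℂ :=
  fun i => Sum.elim x c (e.symm i)

lemma contDiff_coordSlice (e : Fin k ⊕ Fin ℓ ≃ Fin m) (c : Fin ℓ → ℂ) {r : WithTop ℕ∞} :
    ContDiff ℂ r (coordSlice e c) := by
  refine contDiff_pi.2 fun i => ?_
  unfold coordSlice
  rcases e.symm i with j | j
  · exact contDiff_apply ℂ ℂ j
  · exact contDiff_const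

/-- The local right inverse of `(x, v) ↦ exp(Ψ v) • coordSlice e c x` near `v = 0`. -/
lemma exists_rightInverse_coordSlice (e : Fin k ⊕ Fin ℓ ≃ Fin m) {c : Fin ℓ → ℂ}
    (hc : ∀ j, c j ≠ 0)
    (hΨ : Function.Injective fun (v : Fin ℓ → ℂ) (j : Fin ℓ) => Ψ v (e (Sum.inr j)))
    (x : Fin k → ℂ) :
    ∃ g : (Fin m → ℂ) → (Fin k → ℂ) × (Fin ℓ → ℂ),
      ContDiffAt ℂ ω g (coordSlice e c x) ∧ g (coordSlice e c x) = (x, 0) ∧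
      ∀ᶠ z in 𝓝 (coordSlice e c x), expFlow Ψ (g z).2 (coordSlice e c (g z).1) = z := by
  set A₀ : (Fin ℓ → ℂ) →ₗ[ℂ] (Fin ℓ → ℂ) :=
    LinearMap.pi fun j => LinearMap.proj (e (Sum.inr j)) ∘ₗ Ψ
  set A : (Fin ℓ → ℂ) ≃ₗ[ℂ] (Fin ℓ → ℂ) := LinearEquiv.ofInjectiveEndo A₀ hΨ
  have hA : ∀ v j, A v j = Ψ v (e (Sum.inr j)) := fun v j => rfl
  -- `s z` is the time for which flowing back by `-s z` restores the frozen coordinates to `c`. The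
  -- principal logarithm is holomorphic here, since the ratios are near `1`.
  set s : (Fin m → ℂ) → (Fin ℓ → ℂ) := fun z =>
    A.toContinuousLinearEquiv.symm fun j => Complex.log (z (e (Sum.inr j)) / c j) with hs
  have hsΨ : ∀ z j, Ψ (s z) (e (Sum.inr j)) = Complex.log (z (e (Sum.inr j)) / c j) := by
    intro z j
    rw [← hA]
    exact congrFun (A.apply_symm_apply _) j
  have hs0 : s (coordSlice e c x) = 0 := by
    have : (fun j => Complex.log (coordSlice e c x (e (Sum.inr j)) / c j)) = 0 := by
      ext j
      simp [coordSlice, div_self (hc j)]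
    simp only [hs, this, map_zero]
  have hsc : ContDiffAt ℂ ω s (coordSlice e c x) := by
    refine A.toContinuousLinearEquiv.symm.contDiff.contDiffAt.comp _ (contDiffAt_pi.2 fun j => ?_)
    refine AnalyticAt.contDiffAt (AnalyticAt.clog
      ((contDiff_apply ℂ ℂ _).contDiffAt.div_const _).analyticAt ?_)
    simp [coordSlice, div_self (hc _)]
  refine ⟨fun z => (fun i => expFlow Ψ (-s z) z (e (Sum.inl i)), s z), ?_, ?_, ?_⟩
  · refine ContDiffAt.prodMk (contDiffAt_pi.2 fun i => ?_) hsc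
    exact contDiffAt_pi.1 ((contDiff_expFlow (Ψ := Ψ)).contDiffAt.comp _
      (hsc.neg.prodMk contDiffAt_id)) _
  · simp only [hs0]
    simp [coordSlice]
  · have hne : ∀ᶠ z in 𝓝 (coordSlice e c x), ∀ j, z (e (Sum.inr j)) ≠ 0 := by
      refine Filter.eventually_all.2 fun j => ?_
      refine (continuous_apply (e (Sum.inr j))).continuousAt.eventually_ne ?_
      simp [coordSlice, hc j]
    filter_upwards [hne] with z hz
    have : coordSlice e c (fun i => expFlow Ψ (-s z) z (e (Sum.inl i))) = expFlow Ψ (-s z) z := by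
      ext i
      obtain ⟨i, rfl⟩ := e.surjective i
      rcases i with i | j
      · simp [coordSlice]
      · have h1 : z (e (Sum.inr j)) ≠ 0 := hz j
        have h2 := hc j
        simp only [coordSlice, Equiv.symm_apply_apply, Sum.elim_inr, expFlow, map_neg, Pi.neg_apply,
          hsΨ, Complex.exp_neg]
        rw [Complex.exp_log (div_ne_zero h1 h2)]
        field_simp
    simp only [this, expFlow_expFlow_neg]

/-- The map `(x, v) ↦ exp(Ψ v) σ(x)` has local holomorphic right inverses, so only injectivity for
unbounded `v` is at stake. Two slice points on one orbit have equal frozen coordinates, so the times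
differ by periods in `2πiℤ` there. That difference is also a difference of values of `ν`, and a base
on which `ν` varies little leaves only the zero period. -/
lemma exists_localSlice {ν : (Fin m → ℂ) → (Fin ℓ → ℂ)}
    (hν : ∀ z ∈ arrangementComplement K, ∀ v, ν (expFlow Ψ v z) = ν z - v)
    (hνc : ContinuousOn ν (arrangementComplement K)) {z₀ : Fin m → ℂ}
    (hz₀ : z₀ ∈ arrangementComplement K) (e : Fin k ⊕ Fin ℓ ≃ Fin m)
    (hne : ∀ j, z₀ (e (Sum.inr j)) ≠ 0)
    (hΨ : Function.Injective fun (v : Fin ℓ → ℂ) (j : Fin ℓ) => Ψ v (e (Sum.inr j))) :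
    ∃ T : LocalSlice K Ψ (Fin k → ℂ), z₀ ∈ T.triv.source := by
  set c : Fin ℓ → ℂ := fun j => z₀ (e (Sum.inr j)) with hc
  set σ := coordSlice (k := k) e c with hσ
  have hσc : Continuous σ := (contDiff_coordSlice e c (r := 0)).continuous
  set x₀ : Fin k → ℂ := fun i => z₀ (e (Sum.inl i))
  have hσx₀ : σ x₀ = z₀ := by
    ext i
    obtain ⟨i, rfl⟩ := e.surjective i
    rcases i with i | j <;> simp [hσ, coordSlice, x₀, hc]
  -- With bound `π / 2`, imaginary parts for two points of `W` differ by less than `π`, so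
  -- `Complex.log_exp` applies to the difference.
  set W : Set (Fin ℓ → ℂ) :=
    ⋂ j, {w | |(Ψ w (e (Sum.inr j))).im - (Ψ (ν z₀) (e (Sum.inr j))).im| < Real.pi / 2} with hW
  have hWo : IsOpen W := by
    refine isOpen_iInter_of_finite fun j => isOpen_lt ?_ continuous_const
    have : Continuous fun w => Ψ w (e (Sum.inr j)) :=
      (continuous_apply _).comp (contDiff_linearMap_apply (Ψ := Ψ) (n := 0)).continuous
    fun_prop
  set B : Set (Fin k → ℂ) := σ ⁻¹' (arrangementComplement K ∩ ν ⁻¹' W) with hB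
  have hBo : IsOpen B :=
    (hνc.isOpen_inter_preimage (arrangementComplement K).isOpen hWo).preimage hσc
  have hx₀ : x₀ ∈ B := by
    rw [hB, Set.mem_preimage, hσx₀]
    exact ⟨hz₀, by simp [hW, Real.pi_pos]⟩
  have hcd : ContDiff ℂ ω fun p : (Fin k → ℂ) × (Fin ℓ → ℂ) => expFlow Ψ p.2 (σ p.1) :=
    contDiff_expFlow.comp (contDiff_snd.prodMk ((contDiff_coordSlice e c).comp contDiff_fst))
  have hinj : Set.InjOn (fun p : (Fin k → ℂ) × (Fin ℓ → ℂ) => expFlow Ψ p.2 (σ p.1))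
      (B ×ˢ Set.univ) := by
    rintro ⟨x, v⟩ ⟨hx, -⟩ ⟨x', v'⟩ ⟨hx', -⟩ (h : expFlow Ψ v (σ x) = expFlow Ψ v' (σ x'))
    have h1 : ν (σ x) - v = ν (σ x') - v' := by
      rw [← hν _ hx.1, ← hν _ hx'.1, h]
    have h2 : expFlow Ψ (v - v') (σ x) = σ x' := by
      rw [sub_eq_neg_add, ← expFlow_expFlow, h, expFlow_neg_expFlow]
    have h3 : v - v' = ν (σ x) - ν (σ x') := by
      rw [sub_eq_sub_iff_add_eq_add] at h1 ⊢
      rw [add_comm v, h1]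
    have h4 : v - v' = 0 := by
      apply hΨ
      ext1 j
      have h5 := congrFun h2 (e (Sum.inr j))
      have h6 : Complex.exp (Ψ (v - v') (e (Sum.inr j))) = 1 := by
        simpa [expFlow, hσ, coordSlice, hne, hc] using h5
      have h7 := abs_lt.1 (Set.mem_ofPred.1 (Set.mem_iInter.1 hx.2 j))
      have h8 := abs_lt.1 (Set.mem_ofPred.1 (Set.mem_iInter.1 hx'.2 j))
      have h9 : (Ψ (v - v') (e (Sum.inr j))).im =
          (Ψ (ν (σ x)) (e (Sum.inr j))).im - (Ψ (ν (σ x')) (e (Sum.inr j))).im := by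
        rw [h3, map_sub]; simp
      have h10 := Complex.log_exp (x := Ψ (v - v') (e (Sum.inr j)))
        (by rw [h9]; linarith) (by rw [h9]; linarith)
      rw [h6, Complex.log_one] at h10
      simpa using h10.symm
    rw [h4, expFlow_zero] at h2
    have h5 : x = x' := by
      ext i
      simpa [hσ, coordSlice] using congrFun h2 (e (Sum.inl i))
    rw [h5, sub_eq_zero.1 h4]
  obtain ⟨T, hTs, hT, hTc⟩ := exists_openPartialHomeomorph_of_rightInverse (𝕜 := ℂ) (k := ω)
    (hBo.prod isOpen_univ) hinj hcd.continuous.continuousOn (by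
      rintro ⟨x, v⟩ ⟨hx, -⟩
      obtain ⟨g, hg, hgx, hfg⟩ := exists_rightInverse_coordSlice (Ψ := Ψ) e (c := c) hne hΨ x
      have hτ : ContDiff ℂ ω (expFlow Ψ (-v)) :=
        contDiff_expFlow.comp (contDiff_const.prodMk contDiff_id)
      have hτx : expFlow Ψ (-v) (expFlow Ψ v (σ x)) = σ x := expFlow_neg_expFlow _ _
      -- By equivariance, the right inverse at time `0` is transported to time `v`.
      refine ⟨fun z => ((g (expFlow Ψ (-v) z)).1, v + (g (expFlow Ψ (-v) z)).2), ?_, ?_, ?_⟩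
      · have h1 : ContDiffAt ℂ ω (fun z => g (expFlow Ψ (-v) z)) (expFlow Ψ v (σ x)) :=
          ContDiffAt.comp _ (by rw [hτx]; exact hg) hτ.contDiffAt
        exact h1.fst.prodMk (contDiffAt_const.add h1.snd)
      · have : g (σ x) = (x, 0) := hgx
        simp only [hτx, this, add_zero]
      · have h1 : Filter.Tendsto (expFlow Ψ (-v)) (𝓝 (expFlow Ψ v (σ x))) (𝓝 (σ x)) := by
          have := hτ.continuous.tendsto (expFlow Ψ v (σ x))
          rwa [hτx] at this
        filter_upwards [h1.eventually hfg] with z hz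
        simp only [← expFlow_expFlow, hσ, hz, expFlow_expFlow_neg])
  refine ⟨{ triv := T.symm
            base := B
            isOpen_base := hBo
            target_eq := hTs
            source_subset := ?_
            symm_apply := fun x v => by simp [hT]
            contDiffOn := hTc
            contDiffOn_symm := by simpa [hT] using hcd.contDiffOn }, ?_⟩
  · intro z hz
    obtain ⟨⟨x, v⟩, hp, rfl⟩ := T.image_source_eq_target.symm.subset hz
    rw [hTs] at hp
    rw [hT]
    exact expFlow_mem_arrangementComplement hp.1.1 v
  · have : T (x₀, 0) = z₀ := by simp [hT, hσx₀]
    rw [← this]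
    exact T.map_source (by rw [hTs]; exact ⟨hx₀, trivial⟩)

end Existence

/-! ### Calculus of slices -/

section LocalSlice

variable {m ℓ : ℕ} {K : Set (Finset (Fin m))} {Ψ : (Fin ℓ → ℂ) →ₗ[ℂ] (Fin m → ℂ)} {E : Type*}
  [NormedAddCommGroup E] [NormedSpace ℂ E]

namespace LocalSlice

variable (T : LocalSlice K Ψ E)

/-- The slice itself, as a parametrized subset of `ℂ^m`. -/
def sec (x : E) : Fin m → ℂ := T.triv.symm (x, 0)

lemma mem_target {p : E × (Fin ℓ → ℂ)} : p ∈ T.triv.target ↔ p.1 ∈ T.base := by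
  rw [T.target_eq]; simp

lemma contDiffOn_sec : ContDiffOn ℂ ω T.sec T.base :=
  T.contDiffOn_symm.comp (contDiff_prodMk_left 0).contDiffOn fun _ hx => T.mem_target.2 hx

lemma triv_symm (x : E) (v : Fin ℓ → ℂ) : T.triv.symm (x, v) = expFlow Ψ v (T.sec x) :=
  T.symm_apply x v

lemma expFlow_sec_mem {x : E} (hx : x ∈ T.base) (v : Fin ℓ → ℂ) :
    expFlow Ψ v (T.sec x) ∈ T.triv.source := by
  rw [← T.triv_symm]
  exact T.triv.map_target (T.mem_target.2 hx)

lemma sec_mem {x : E} (hx : x ∈ T.base) : T.sec x ∈ T.triv.source :=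
  T.triv.map_target (T.mem_target.2 hx)

lemma triv_expFlow_sec {x : E} (hx : x ∈ T.base) (v : Fin ℓ → ℂ) :
    T.triv (expFlow Ψ v (T.sec x)) = (x, v) := by
  rw [← T.triv_symm]
  exact T.triv.right_inv (T.mem_target.2 hx)

lemma fst_mem {z : Fin m → ℂ} (hz : z ∈ T.triv.source) : (T.triv z).1 ∈ T.base :=
  T.mem_target.1 (T.triv.map_source hz)

lemma expFlow_snd_sec_fst {z : Fin m → ℂ} (hz : z ∈ T.triv.source) :
    expFlow Ψ (T.triv z).2 (T.sec (T.triv z).1) = z := by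
  rw [← T.triv_symm]
  exact T.triv.left_inv hz

lemma expFlow_mem {z : Fin m → ℂ} (hz : z ∈ T.triv.source) (v : Fin ℓ → ℂ) :
    expFlow Ψ v z ∈ T.triv.source := by
  rw [← T.expFlow_snd_sec_fst hz, expFlow_expFlow]
  exact T.expFlow_sec_mem (T.fst_mem hz) _

lemma expFlow_mem_iff {z : Fin m → ℂ} {v : Fin ℓ → ℂ} :
    expFlow Ψ v z ∈ T.triv.source ↔ z ∈ T.triv.source :=
  ⟨fun h => by simpa using T.expFlow_mem h (-v), fun h => T.expFlow_mem h v⟩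

lemma triv_expFlow {z : Fin m → ℂ} (hz : z ∈ T.triv.source) (v : Fin ℓ → ℂ) :
    T.triv (expFlow Ψ v z) = ((T.triv z).1, v + (T.triv z).2) := by
  have h : expFlow Ψ v z = expFlow Ψ (v + (T.triv z).2) (T.sec (T.triv z).1) := by
    rw [← expFlow_expFlow, T.expFlow_snd_sec_fst hz]
  rw [h, T.triv_expFlow_sec (T.fst_mem hz)]

lemma contDiffOn_transition (T' : LocalSlice K Ψ E) :
    ContDiffOn ℂ ω (fun x => (T'.triv (T.sec x)).1) (T.base ∩ T.sec ⁻¹' T'.triv.source) :=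
  (T'.contDiffOn.comp (T.contDiffOn_sec.mono Set.inter_subset_left) fun _ hx => hx.2).fst

end LocalSlice

end LocalSlice

/-! ### Retraction onto `Z_P`, the orbit space, and charts from slices -/

/-- A smooth map `ν` on `U(K_P)` such that `ν z` is the unique `v` with `exp(Ψ v) z ∈ Z_P`. -/
structure Normalization {N : Type*} [NormedAddCommGroup N] [NormedSpace ℝ N] {m ℓ : ℕ}
    (a : Fin m → N) (b : Fin m → ℝ) (Ψ : (Fin ℓ → ℂ) →ₗ[ℂ] (Fin m → ℂ)) where
  /-- The underlying map. -/
  toFun : (Fin m → ℂ) → (Fin ℓ → ℂ)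
  expFlow_mem_iff : ∀ z ∈ arrangementComplement (nerveComplex a b), ∀ v,
    expFlow Ψ v z ∈ polytopeSpace a b ↔ toFun z = v
  contDiffOn : ContDiffOn ℝ ∞ toFun (arrangementComplement (nerveComplex a b))

namespace Normalization

variable {N : Type*} [NormedAddCommGroup N] [NormedSpace ℝ N]
  {m ℓ : ℕ} {a : Fin m → N} {b : Fin m → ℝ} {Ψ : (Fin ℓ → ℂ) →ₗ[ℂ] (Fin m → ℂ)}
  (ν : Normalization a b Ψ)

lemma map_expFlow {z : Fin m → ℂ} (hz : z ∈ arrangementComplement (nerveComplex a b))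
    (v : Fin ℓ → ℂ) : ν.toFun (expFlow Ψ v z) = ν.toFun z - v := by
  rw [← ν.expFlow_mem_iff _ (expFlow_mem_arrangementComplement hz v), expFlow_expFlow,
    sub_add_cancel, ν.expFlow_mem_iff z hz]

lemma map_eq_zero {z : Fin m → ℂ} (hz : z ∈ polytopeSpace a b) : ν.toFun z = 0 := by
  rw [← ν.expFlow_mem_iff z (polytopeSpace_subset a b hz), expFlow_zero]
  exact hz

/-- The retraction of `U(K_P)` onto `Z_P` along the orbits. -/
def retraction (z : arrangementComplement (nerveComplex a b)) : polytopeSpace a b :=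
  ⟨expFlow Ψ (ν.toFun z.1) z.1, (ν.expFlow_mem_iff z.1 z.2 _).2 rfl⟩

lemma contDiffOn_expFlow :
    ContDiffOn ℝ ∞ (fun z => expFlow Ψ (ν.toFun z) z)
      (arrangementComplement (nerveComplex a b)) :=
  ((contDiff_expFlow (n := ∞)).restrict_scalars ℝ).comp_contDiffOn
    (ν.contDiffOn.prodMk contDiffOn_id)

lemma continuous_retraction : Continuous ν.retraction :=
  Continuous.subtype_mk (continuousOn_iff_continuous_domRestrict.1 ν.contDiffOn_expFlow.continuousOn) _

lemma retraction_of_mem (z : polytopeSpace a b) :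
    ν.retraction ⟨z.1, polytopeSpace_subset a b z.2⟩ = z := by
  apply Subtype.ext
  simp [retraction, ν.map_eq_zero z.2]

end Normalization

section Orbits

variable {m ℓ : ℕ} {K : Set (Finset (Fin m))} {Ψ : (Fin ℓ → ℂ) →ₗ[ℂ] (Fin m → ℂ)}

lemma orbitProj_eq_iff {z w : arrangementComplement K} :
    orbitProj K Ψ z = orbitProj K Ψ w ↔ ∃ v, expFlow Ψ v w.1 = z.1 := by
  unfold orbitProj
  rw [Quotient.eq, MulAction.orbitRel_apply]
  constructor
  · rintro ⟨⟨c, _, ⟨v, rfl⟩, hc⟩, hcz⟩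
    refine ⟨v, ?_⟩
    rw [← hcz]
    funext i
    exact congrArg (· * w.1 i) (hc i).symm
  · rintro ⟨v, hv⟩
    refine ⟨⟨fun i => Units.mk0 (Complex.exp (Ψ v i)) (Complex.exp_ne_zero _), Ψ v, ⟨v, rfl⟩,
      fun i => rfl⟩, Subtype.ext ?_⟩
    rw [← hv]
    rfl

lemma continuous_orbitProj : Continuous (orbitProj K Ψ) := continuous_quotient_mk'

end Orbits

namespace Normalization

variable {N : Type*} [NormedAddCommGroup N] [NormedSpace ℝ N]
  {m ℓ : ℕ} {a : Fin m → N} {b : Fin m → ℝ} {Ψ : (Fin ℓ → ℂ) →ₗ[ℂ] (Fin m → ℂ)}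
  (ν : Normalization a b Ψ)

lemma orbitProj_retraction (z : arrangementComplement (nerveComplex a b)) :
    toOrbitSpace a b Ψ (ν.retraction z) = orbitProj _ Ψ z :=
  orbitProj_eq_iff.2 ⟨ν.toFun z.1, rfl⟩

lemma retraction_eq_of_orbitProj_eq {z w : arrangementComplement (nerveComplex a b)}
    (h : orbitProj _ Ψ z = orbitProj _ Ψ w) : ν.retraction z = ν.retraction w := by
  obtain ⟨v, hv⟩ := orbitProj_eq_iff.1 h
  apply Subtype.ext
  simp only [retraction, ← hv, ν.map_expFlow w.2, expFlow_expFlow, sub_add_cancel]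

/-- The homeomorphism `Z_P ≃ U(K_P)/C`. -/
def homeomorph : polytopeSpace a b ≃ₜ OrbitSpace (nerveComplex a b) Ψ where
  toFun := toOrbitSpace a b Ψ
  invFun := Quotient.lift ν.retraction fun _ _ h =>
    ν.retraction_eq_of_orbitProj_eq (Quotient.sound h)
  left_inv z := ν.retraction_of_mem z
  right_inv o := by
    induction o using Quotient.inductionOn with
    | h z => exact ν.orbitProj_retraction z
  continuous_toFun := continuous_orbitProj.comp (continuous_subtype_val.subtype_mk _)
  continuous_invFun := ν.continuous_retraction.quotient_lift _

open Classical in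
/-- The retraction onto `Z_P`, extended to `ℂ^m` by a constant. -/
def extRetraction (z₀ : polytopeSpace a b) (z : Fin m → ℂ) : polytopeSpace a b :=
  if h : z ∈ arrangementComplement (nerveComplex a b) then ν.retraction ⟨z, h⟩ else z₀

lemma coe_extRetraction (z₀ : polytopeSpace a b) {z : Fin m → ℂ}
    (hz : z ∈ arrangementComplement (nerveComplex a b)) :
    (ν.extRetraction z₀ z : Fin m → ℂ) = expFlow Ψ (ν.toFun z) z := by
  rw [extRetraction, dif_pos hz]
  rfl

variable {E : Type*} [NormedAddCommGroup E] [NormedSpace ℂ E]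
  (T : LocalSlice (nerveComplex a b) Ψ E)

lemma sec_mem {x : E} (hx : x ∈ T.base) : T.sec x ∈ arrangementComplement (nerveComplex a b) :=
  T.source_subset (T.sec_mem hx)

/-- The chart of `Z_P` given by a local slice of the action on `U(K_P)`. -/
def chart (z₀ : polytopeSpace a b) : OpenPartialHomeomorph (polytopeSpace a b) E where
  toFun z := (T.triv z.1).1
  invFun x := ν.extRetraction z₀ (T.sec x)
  source := {z | z.1 ∈ T.triv.source}
  target := T.base
  map_source' _ hz := T.fst_mem hz
  map_target' x hx := by
    change (ν.extRetraction z₀ (T.sec x)).1 ∈ T.triv.source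
    rw [ν.coe_extRetraction z₀ (sec_mem T hx)]
    exact T.expFlow_sec_mem hx _
  left_inv' z hz := by
    have hx := T.fst_mem hz
    apply Subtype.ext
    rw [ν.coe_extRetraction z₀ (sec_mem T hx)]
    -- Since `ν` vanishes on `Z_P`, the fibre coordinate of `z` must be the value of `ν` at its
    -- slice point.
    have h1 := T.expFlow_snd_sec_fst hz
    have h2 := ν.map_expFlow (sec_mem T hx) (T.triv z.1).2
    rw [h1, ν.map_eq_zero z.2] at h2
    rw [← sub_eq_zero.1 h2.symm] at h1
    exact h1
  right_inv' x hx := by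
    rw [ν.coe_extRetraction z₀ (sec_mem T hx), T.triv_expFlow_sec hx]
  open_source := T.triv.open_source.preimage continuous_subtype_val
  open_target := T.isOpen_base
  continuousOn_toFun := continuous_fst.comp_continuousOn
    (T.triv.continuousOn.comp continuous_subtype_val.continuousOn fun _ h => h)
  continuousOn_invFun := by
    rw [Topology.IsInducing.subtypeVal.continuousOn_iff]
    refine ContinuousOn.congr ?_ fun x hx => ν.coe_extRetraction z₀ (sec_mem T hx)
    exact ν.contDiffOn_expFlow.continuousOn.comp T.contDiffOn_sec.continuousOn
      fun _ hx => sec_mem T hx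

variable (z₀ z₁ : polytopeSpace a b)

lemma coe_chart_symm {x : E} (hx : x ∈ T.base) :
    ((ν.chart T z₀).symm x : Fin m → ℂ) = expFlow Ψ (ν.toFun (T.sec x)) (T.sec x) :=
  ν.coe_extRetraction z₀ (sec_mem T hx)

/-- The inverse chart flows the slice point by `ν`, which is only smooth. The base coordinate of the
second slice is constant along orbits, so this flow drops out and the transition is the holomorphic
change of slice. -/
lemma contDiffOn_chart_transition (T' : LocalSlice (nerveComplex a b) Ψ E) :
    ContDiffOn ℂ ω ((ν.chart T z₀).symm ≫ₕ ν.chart T' z₁)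
      ((ν.chart T z₀).symm ≫ₕ ν.chart T' z₁).source := by
  have hmem : ∀ x ∈ ((ν.chart T z₀).symm ≫ₕ ν.chart T' z₁).source,
      x ∈ T.base ∧ T.sec x ∈ T'.triv.source := by
    rintro x ⟨hx, hx'⟩
    have hx : x ∈ T.base := hx
    refine ⟨hx, ?_⟩
    have h : ((ν.chart T z₀).symm x : Fin m → ℂ) ∈ T'.triv.source := hx'
    rwa [ν.coe_chart_symm T z₀ hx, T'.expFlow_mem_iff] at h
  refine ((T.contDiffOn_transition T').mono hmem).congr fun x hx => ?_
  change (T'.triv ((ν.chart T z₀).symm x : Fin m → ℂ)).1 = _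
  rw [ν.coe_chart_symm T z₀ (hmem x hx).1, T'.triv_expFlow (hmem x hx).2]

/-- The chart of `ℂ^m` around a point of `Z_P` which straightens both the orbits and `Z_P`. -/
def straightening : OpenPartialHomeomorph (Fin m → ℂ) (E × (Fin ℓ → ℂ)) where
  toFun z := ((T.triv z).1, ν.toFun z)
  -- Flowing by `v` lowers `ν` by `v`, so this time makes `ν` equal to `p.2`.
  invFun p := expFlow Ψ (ν.toFun (T.sec p.1) - p.2) (T.sec p.1)
  source := T.triv.source
  target := T.base ×ˢ Set.univ
  map_source' _ hz := ⟨T.fst_mem hz, trivial⟩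
  map_target' p hp := T.expFlow_sec_mem hp.1 _
  left_inv' z hz := by
    have hx := T.fst_mem hz
    have h1 := T.expFlow_snd_sec_fst hz
    have h2 := ν.map_expFlow (sec_mem T hx) (T.triv z).2
    rw [h1] at h2
    change expFlow Ψ (ν.toFun (T.sec (T.triv z).1) - ν.toFun z) (T.sec (T.triv z).1) = z
    rw [h2, sub_sub_cancel, h1]
  right_inv' p hp := by
    rw [T.triv_expFlow_sec hp.1, ν.map_expFlow (sec_mem T hp.1), sub_sub_cancel]
  open_source := T.triv.open_source
  open_target := T.isOpen_base.prod isOpen_univ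
  continuousOn_toFun := (continuous_fst.comp_continuousOn T.triv.continuousOn).prodMk
    (ν.contDiffOn.continuousOn.mono T.source_subset)
  continuousOn_invFun := by
    have h1 : ContinuousOn (fun p : E × (Fin ℓ → ℂ) => T.sec p.1) (T.base ×ˢ Set.univ) :=
      T.contDiffOn_sec.continuousOn.comp continuousOn_fst fun _ hp => hp.1
    have h2 := ν.contDiffOn.continuousOn.comp h1 fun p hp => sec_mem T hp.1
    exact (contDiff_expFlow (n := 0)).continuous.comp_continuousOn
      ((h2.sub continuousOn_snd).prodMk h1)

variable [NormedSpace ℝ E] [IsScalarTower ℝ ℂ E]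

lemma contDiffOn_straightening :
    ContDiffOn ℝ ∞ (ν.straightening T) (ν.straightening T).source :=
  ((T.contDiffOn.restrict_scalars ℝ).of_le le_top).fst.prodMk (ν.contDiffOn.mono T.source_subset)

lemma contDiffOn_straightening_symm :
    ContDiffOn ℝ ∞ (ν.straightening T).symm (ν.straightening T).target := by
  have h1 : ContDiffOn ℝ ∞ (fun p : E × (Fin ℓ → ℂ) => T.sec p.1) (T.base ×ˢ Set.univ) :=
    ((T.contDiffOn_sec.restrict_scalars ℝ).of_le le_top).comp contDiffOn_fst fun _ hp => hp.1
  have h2 := ν.contDiffOn.comp h1 fun p hp => sec_mem T hp.1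
  exact ((contDiff_expFlow (n := ∞)).restrict_scalars ℝ).comp_contDiffOn
    ((h2.sub contDiffOn_snd).prodMk h1)

end Normalization

/-! ### Manifold structures from charts -/

section ChartedSpaces

variable {𝕜 E E' X X' : Type*} [NontriviallyNormedField 𝕜]
  [NormedAddCommGroup E] [NormedSpace 𝕜 E] [NormedAddCommGroup E'] [NormedSpace 𝕜 E']
  [TopologicalSpace X] [TopologicalSpace X'] {k : WithTop ℕ∞}

/-- The charted space structure given by a choice of a chart around each point. -/
@[reducible] def chartedSpaceOfCharts {H : Type*} [TopologicalSpace H]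
    (c : X → OpenPartialHomeomorph X H) (hc : ∀ x, x ∈ (c x).source) : ChartedSpace H X where
  atlas := Set.range c
  chartAt := c
  mem_chart_source := hc
  chart_mem_atlas x := ⟨x, rfl⟩

lemma isManifold_chartedSpaceOfCharts (c : X → OpenPartialHomeomorph X E)
    (hc : ∀ x, x ∈ (c x).source)
    (h : ∀ x y, ContDiffOn 𝕜 k ((c x).symm ≫ₕ c y) ((c x).symm ≫ₕ c y).source) :
    letI := chartedSpaceOfCharts c hc
    IsManifold 𝓘(𝕜, E) k X := by
  let _ := chartedSpaceOfCharts c hc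
  refine isManifold_of_contDiffOn _ _ _ ?_
  rintro _ _ ⟨x, rfl⟩ ⟨y, rfl⟩
  simpa using h x y

/-- A map which is linear in suitable charts is smooth. -/
lemma contMDiff_of_chartAt_eq [ChartedSpace E X] [ChartedSpace E' X'] {f : X → X'}
    (hf : Continuous f) (A : E →L[𝕜] E')
    (h : ∀ x, ∀ y ∈ (chartAt E x).target, chartAt E' (f x) (f ((chartAt E x).symm y)) = A y) :
    ContMDiff 𝓘(𝕜, E) 𝓘(𝕜, E') k f := by
  intro x
  rw [contMDiffAt_iff]
  refine ⟨hf.continuousAt, ?_⟩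
  refine ContDiffAt.contDiffWithinAt ?_
  refine A.contDiff.contDiffAt.congr_of_eventuallyEq ?_
  have hmem : (chartAt E x).target ∈ 𝓝 (extChartAt 𝓘(𝕜, E) x x) := by
    simpa using (chartAt E x).open_target.mem_nhds (mem_chart_target E x)
  filter_upwards [hmem] with y hy
  simpa using h x y hy

lemma mem_contDiffGroupoid_of_contDiffOn {e : OpenPartialHomeomorph E E}
    (h : ContDiffOn 𝕜 k e e.source) (h' : ContDiffOn 𝕜 k e.symm e.target) :
    e ∈ contDiffGroupoid k 𝓘(𝕜, E) := by
  rw [contDiffGroupoid, mem_groupoid_of_pregroupoid]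
  simpa [contDiffPregroupoid] using ⟨h, h'⟩

lemma mem_maximalAtlas_of_mem_contDiffGroupoid {e : OpenPartialHomeomorph E E}
    (h : e ∈ contDiffGroupoid k 𝓘(𝕜, E)) : e ∈ IsManifold.maximalAtlas 𝓘(𝕜, E) k E := by
  rw [IsManifold.mem_maximalAtlas_iff]
  exact StructureGroupoid.mem_maximalAtlas_of_mem_groupoid _ h

lemma subtypeRestr_mem_maximalAtlas {e : OpenPartialHomeomorph E E}
    (h : e ∈ contDiffGroupoid k 𝓘(𝕜, E)) {s : TopologicalSpace.Opens E} (hs : Nonempty s) :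
    e.subtypeRestr hs ∈ IsManifold.maximalAtlas 𝓘(𝕜, E) k s := by
  have key : ∀ f g : OpenPartialHomeomorph E E, f ∈ contDiffGroupoid k 𝓘(𝕜, E) →
      g ∈ contDiffGroupoid k 𝓘(𝕜, E) →
      (f.subtypeRestr hs).symm ≫ₕ g.subtypeRestr hs ∈ contDiffGroupoid k 𝓘(𝕜, E) := by
    intro f g hf hg
    exact StructureGroupoid.mem_of_eqOnSource _
      (closedUnderRestriction' ((contDiffGroupoid k 𝓘(𝕜, E)).trans
        ((contDiffGroupoid k 𝓘(𝕜, E)).symm hf) hg) (f.isOpen_inter_preimage_symm s.2))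
      (f.subtypeRestr_symm_trans_subtypeRestr hs g)
  rw [IsManifold.mem_maximalAtlas_iff, mem_maximalAtlas_iff]
  intro e' he'
  obtain ⟨x, rfl⟩ := TopologicalSpace.Opens.chart_eq hs he'
  have hx : chartAt E (x : E) ∈ contDiffGroupoid k 𝓘(𝕜, E) := by
    rw [chartAt_self_eq]
    exact StructureGroupoid.id_mem _
  exact ⟨key _ _ h hx, key _ _ hx h⟩

end ChartedSpaces

/-- This lets one family of charts carry both structures on `Z_P`: the real charts are the complex
ones followed by a fixed real-linear isomorphism. -/
lemma contDiffOn_conj {E E' : Type*} [NormedAddCommGroup E] [NormedSpace ℂ E] [NormedSpace ℝ E]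
    [IsScalarTower ℝ ℂ E] [NormedAddCommGroup E'] [NormedSpace ℝ E'] {X : Type*}
    [TopologicalSpace X] (L : E ≃L[ℝ] E') {c c' : OpenPartialHomeomorph X E}
    (h : ContDiffOn ℂ ω (c.symm ≫ₕ c') (c.symm ≫ₕ c').source) :
    ContDiffOn ℝ ∞ ((c.transHomeomorph L.toHomeomorph).symm ≫ₕ c'.transHomeomorph L.toHomeomorph)
      ((c.transHomeomorph L.toHomeomorph).symm ≫ₕ c'.transHomeomorph L.toHomeomorph).source :=
  L.contDiff.comp_contDiffOn
    (((h.restrict_scalars ℝ).of_le le_top).comp L.symm.contDiff.contDiffOn fun _ hx => hx)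

/-! ### The submersion and the embedding in adapted charts -/

namespace Normalization

variable {N : Type*} [NormedAddCommGroup N] [NormedSpace ℝ N]
  {m ℓ : ℕ} {a : Fin m → N} {b : Fin m → ℝ} {Ψ : (Fin ℓ → ℂ) →ₗ[ℂ] (Fin m → ℂ)}
  (ν : Normalization a b Ψ) {k : ℕ}
  (T : polytopeSpace a b → LocalSlice (nerveComplex a b) Ψ (Fin k → ℂ))
  (hT : ∀ z, z.1 ∈ (T z).triv.source)

/-- The charts of the complex structure on `Z_P`. -/
def complexChart (z : polytopeSpace a b) :
    OpenPartialHomeomorph (polytopeSpace a b) (Fin k → ℂ) :=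
  ν.chart (T z) z

/-- The charts of the smooth structure on `Z_P`. -/
def realChart {H : Type*} [NormedAddCommGroup H] [NormedSpace ℝ H] (L : (Fin k → ℂ) ≃L[ℝ] H)
    (z : polytopeSpace a b) : OpenPartialHomeomorph (polytopeSpace a b) H :=
  (ν.complexChart T z).transHomeomorph L.toHomeomorph

/-- The charts of the complex structure on `U(K_P)/C`. -/
def orbitChart (o : OrbitSpace (nerveComplex a b) Ψ) :
    OpenPartialHomeomorph (OrbitSpace (nerveComplex a b) Ψ) (Fin k → ℂ) :=
  ν.homeomorph.symm.transOpenPartialHomeomorph (ν.complexChart T (ν.homeomorph.symm o))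

lemma orbitChart_homeomorph (x z : polytopeSpace a b) :
    ν.orbitChart T (ν.homeomorph x) (ν.homeomorph z) = ν.complexChart T x z := by
  simp [orbitChart]

/-- `U(K_P) → U(K_P)/C` is a holomorphic submersion. -/
lemma isSubmersion_orbitProj (hm : m = k + ℓ) (hT : ∀ z, z.1 ∈ (T z).triv.source) :
    letI := chartedSpaceOfCharts (ν.orbitChart T) fun o => hT (ν.homeomorph.symm o)
    IsManifold 𝓘(ℂ, Fin k → ℂ) ω (OrbitSpace (nerveComplex a b) Ψ) →
    Manifold.IsSubmersion 𝓘(ℂ, Fin m → ℂ) 𝓘(ℂ, Fin k → ℂ) ω (orbitProj (nerveComplex a b) Ψ) := by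
  let _ := chartedSpaceOfCharts (ν.orbitChart T) fun o => hT (ν.homeomorph.symm o)
  intro hman
  have hrank : Module.finrank ℂ (Fin m → ℂ) = Module.finrank ℂ ((Fin k → ℂ) × (Fin ℓ → ℂ)) := by
    simp [hm]
  set M : (Fin m → ℂ) ≃L[ℂ] (Fin k → ℂ) × (Fin ℓ → ℂ) := ContinuousLinearEquiv.ofFinrankEq hrank
  refine ⟨Fin ℓ → ℂ, inferInstance, inferInstance, fun z => ?_⟩
  set S := T (ν.retraction z) with hS
  -- The domain of a slice is invariant under the flow, so a slice chosen at the retracted point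
  -- also covers `z`.
  have hzS : ∀ w : arrangementComplement (nerveComplex a b),
      (ν.retraction w).1 ∈ S.triv.source ↔ w.1 ∈ S.triv.source := fun w => S.expFlow_mem_iff
  have hz : z.1 ∈ S.triv.source := (hzS z).1 (hT _)
  set e := S.triv.transHomeomorph M.symm.toHomeomorph
  have he : e ∈ contDiffGroupoid ω 𝓘(ℂ, Fin m → ℂ) := by
    refine mem_contDiffGroupoid_of_contDiffOn ?_ ?_
    · exact M.symm.contDiff.comp_contDiffOn S.contDiffOn
    · exact S.contDiffOn_symm.comp M.contDiff.contDiffOn fun _ hx => hx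
  refine Manifold.IsSubmersionAtOfComplement.mk_of_charts M (e.subtypeRestr ⟨z⟩)
    (chartAt _ (orbitProj _ Ψ z)) ?_ (mem_chart_source _ _) (subtypeRestr_mem_maximalAtlas he _)
    (IsManifold.chart_mem_maximalAtlas _) ?_ ?_
  · rwa [e.subtypeRestr_source]
  · intro w hw
    rw [e.subtypeRestr_source] at hw
    exact (hzS w).2 hw
  · intro y hy
    have hy : y ∈ (e.subtypeRestr ⟨z⟩).target := by simpa using hy
    have hw := (e.subtypeRestr ⟨z⟩).map_target hy
    have hwy := (e.subtypeRestr ⟨z⟩).right_inv hy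
    set w := (e.subtypeRestr ⟨z⟩).symm y with hwdef
    rw [e.subtypeRestr_source] at hw
    have h1 : M.symm (S.triv w.1) = y := hwy
    have h2 : S.triv w.1 = M y := by rw [← h1, M.apply_symm_apply]
    -- Retracting changes only the fibre coordinate, so in these charts the projection is
    -- `Prod.fst`.
    have h3 : (S.triv (ν.retraction w).1).1 = (M y).1 := by
      rw [← h2]
      exact (congrArg Prod.fst (S.triv_expFlow hw _) :)
    exact h3

/-- `Z_P ⊆ ℂ^m` is an embedded submanifold. -/
lemma isSmoothEmbedding_val (hm : m = k + ℓ) (hT : ∀ z, z.1 ∈ (T z).triv.source) {H : Type*}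
    [NormedAddCommGroup H] [NormedSpace ℝ H] (L : (Fin k → ℂ) ≃L[ℝ] H) :
    letI := chartedSpaceOfCharts (ν.realChart T L) hT
    IsManifold 𝓘(ℝ, H) ∞ (polytopeSpace a b) →
    Manifold.IsSmoothEmbedding 𝓘(ℝ, H) 𝓘(ℝ, Fin m → ℂ) ∞
      (Subtype.val : polytopeSpace a b → (Fin m → ℂ)) := by
  let _ := chartedSpaceOfCharts (ν.realChart T L) hT
  intro hman
  have hrank : Module.finrank ℝ ((Fin k → ℂ) × (Fin ℓ → ℂ)) = Module.finrank ℝ (Fin m → ℂ) := by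
    simp [Module.finrank_prod, Module.finrank_pi_fintype, hm, add_mul]
  set M : ((Fin k → ℂ) × (Fin ℓ → ℂ)) ≃L[ℝ] (Fin m → ℂ) := ContinuousLinearEquiv.ofFinrankEq hrank
  refine ⟨⟨Fin ℓ → ℂ, inferInstance, inferInstance, fun z => ?_⟩, Topology.IsEmbedding.subtypeVal⟩
  set S := T z with hS
  set e := (ν.straightening S).transHomeomorph M.toHomeomorph
  have he : e ∈ contDiffGroupoid ∞ 𝓘(ℝ, Fin m → ℂ) := by
    refine mem_contDiffGroupoid_of_contDiffOn ?_ ?_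
    · exact M.contDiff.comp_contDiffOn (ν.contDiffOn_straightening S)
    · exact (ν.contDiffOn_straightening_symm S).comp M.symm.contDiff.contDiffOn fun _ hx => hx
  refine Manifold.IsImmersionAtOfComplement.mk_of_charts
    ((L.symm.prodCongr (ContinuousLinearEquiv.refl ℝ (Fin ℓ → ℂ))).trans M)
    (chartAt _ z) e (mem_chart_source _ _) (hT z) (IsManifold.chart_mem_maximalAtlas _)
    (mem_maximalAtlas_of_mem_contDiffGroupoid he) (fun w hw => hw) ?_
  intro y hy
  have hy : y ∈ (chartAt H z).target := by simpa using hy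
  have hwy := (ν.realChart T L z).right_inv hy
  set w := (ν.realChart T L z).symm y with hwdef
  have h1 : L (S.triv w.1).1 = y := hwy
  have h2 : (S.triv w.1).1 = L.symm y := by rw [← h1, L.symm_apply_apply]
  -- On `Z_P` the second straightened coordinate is `0`, so the inclusion becomes `x ↦ (x, 0)`.
  have h3 : M ((S.triv w.1).1, ν.toFun w.1) = M (L.symm y, 0) := by
    rw [h2, ν.map_eq_zero w.2]
  exact h3

end Normalization

lemma toOrbitSpace_smul {N : Type*} [NormedAddCommGroup N] [NormedSpace ℝ N] {m ℓ : ℕ}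
    (a : Fin m → N) (b : Fin m → ℝ) (Ψ : (Fin ℓ → ℂ) →ₗ[ℂ] (Fin m → ℂ)) (t : Fin m → Circle)
    (z : polytopeSpace a b) : toOrbitSpace a b Ψ (t • z) = t • toOrbitSpace a b Ψ z := rfl

end MomentAngle

end

/-! ### Assembly of the structures -/

open MomentAngle

theorem theorem3p4 {N : Type*} [NormedAddCommGroup N] [NormedSpace ℝ N] [FiniteDimensional ℝ N]
    {n m ℓ : ℕ} (hn : Module.finrank ℝ N = n) (hm : m = n + 2 * ℓ)
    (a : Fin m → N) (b : Fin m → ℝ) (hP : IsSimplePolytope a b)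
    (Ψ : (Fin ℓ → ℂ) →ₗ[ℂ] (Fin m → ℂ)) (hΨ : IsAdmissible a Ψ) :
    -- `Z_P` is the intersection of the Hermitian quadrics given by any basis of the linear
    -- relations between the vectors `a i`
    (∀ Γ : Matrix (Fin (2 * ℓ)) (Fin m) ℝ, LinearIndependent ℝ Γ.row →
      Submodule.span ℝ (Set.range Γ.row) = LinearMap.ker (Fintype.linearCombination ℝ a) →
      polytopeSpace a b = hermitianQuadrics Γ b) ∧
    -- `U(K_P)/C` is a Hausdorff, second countable space
    T2Space (OrbitSpace (nerveComplex a b) Ψ) ∧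
    SecondCountableTopology (OrbitSpace (nerveComplex a b) Ψ) ∧
    ∃ (_ : ChartedSpace (EuclideanSpace ℝ (Fin (m + n))) (polytopeSpace a b))
      (_ : ChartedSpace (Fin (n + ℓ) → ℂ) (OrbitSpace (nerveComplex a b) Ψ)),
      -- `Z_P` is a smooth submanifold of `ℂ^m` of dimension `m + n`
      IsManifold 𝓘(ℝ, EuclideanSpace ℝ (Fin (m + n))) ∞ (polytopeSpace a b) ∧
      Manifold.IsSmoothEmbedding 𝓘(ℝ, EuclideanSpace ℝ (Fin (m + n))) 𝓘(ℝ, Fin m → ℂ) ∞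
        (Subtype.val : polytopeSpace a b → (Fin m → ℂ)) ∧
      -- `U(K_P)/C` is the quotient complex manifold, of complex dimension `n + ℓ = m - ℓ`
      IsManifold 𝓘(ℂ, Fin (n + ℓ) → ℂ) ω (OrbitSpace (nerveComplex a b) Ψ) ∧
      Manifold.IsSubmersion 𝓘(ℂ, Fin m → ℂ) 𝓘(ℂ, Fin (n + ℓ) → ℂ) ω
        (orbitProj (nerveComplex a b) Ψ) ∧
      -- `Z_P → U(K_P)/C` is a `T^m`-equivariant diffeomorphism of real smooth manifolds
      (∃ Φ : Diffeomorph 𝓘(ℝ, EuclideanSpace ℝ (Fin (m + n))) 𝓘(ℝ, Fin (n + ℓ) → ℂ)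
          (polytopeSpace a b) (OrbitSpace (nerveComplex a b) Ψ) ∞,
        ⇑Φ = toOrbitSpace a b Ψ) ∧
      (∀ (t : Fin m → Circle) (z : polytopeSpace a b),
        toOrbitSpace a b Ψ (t • z) = t • toOrbitSpace a b Ψ z) ∧
      -- it endows `Z_P` with a complex structure: one that is compatible with the smooth structure
      -- of the submanifold `Z_P ⊆ ℂ^m` and makes the map to `U(K_P)/C` biholomorphic
      ∃ _ : ChartedSpace (Fin (n + ℓ) → ℂ) (polytopeSpace a b),
        IsManifold 𝓘(ℂ, Fin (n + ℓ) → ℂ) ω (polytopeSpace a b) ∧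
        (∃ ι : Diffeomorph 𝓘(ℝ, EuclideanSpace ℝ (Fin (m + n))) 𝓘(ℝ, Fin (n + ℓ) → ℂ)
            (polytopeSpace a b) (polytopeSpace a b) ∞, ⇑ι = id) ∧
        ∃ Θ : Diffeomorph 𝓘(ℂ, Fin (n + ℓ) → ℂ) 𝓘(ℂ, Fin (n + ℓ) → ℂ)
            (polytopeSpace a b) (OrbitSpace (nerveComplex a b) Ψ) ω,
          ⇑Θ = toOrbitSpace a b Ψ := by
  classical
  obtain ⟨f, hf, hfc⟩ := exists_normalization hΨ hn hm hP
  let ν : Normalization a b Ψ := ⟨f, hf, hfc⟩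
  have hslice : ∀ z : polytopeSpace a b,
      ∃ T : LocalSlice (nerveComplex a b) Ψ (Fin (n + ℓ) → ℂ), z.1 ∈ T.triv.source := by
    intro z
    have hz := polytopeSpace_subset a b z.2
    obtain ⟨e, hne, he⟩ := exists_separating_coordinates (Ψ := Ψ) hm (z := z.1) fun v hv =>
      hΨ.eq_zero_of_re_eq_zero hP hz fun i hi => by rw [hv i hi, Complex.zero_re]
    exact exists_localSlice (fun z hz v => ν.map_expFlow hz v) hfc.continuousOn hz e hne he
  choose T hT using hslice
  have hmk : m = n + ℓ + ℓ := by omega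
  have hrank : Module.finrank ℝ (Fin (n + ℓ) → ℂ) =
      Module.finrank ℝ (EuclideanSpace ℝ (Fin (m + n))) := by
    rw [Module.finrank_pi_fintype, finrank_euclideanSpace_fin]
    simp only [Complex.finrank_real_complex, Finset.sum_const, Finset.card_univ, Fintype.card_fin,
      smul_eq_mul]
    omega
  let L : (Fin (n + ℓ) → ℂ) ≃L[ℝ] EuclideanSpace ℝ (Fin (m + n)) :=
    ContinuousLinearEquiv.ofFinrankEq hrank
  let φ := ν.homeomorph
  let cR : ChartedSpace (EuclideanSpace ℝ (Fin (m + n))) (polytopeSpace a b) :=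
    chartedSpaceOfCharts (ν.realChart T L) hT
  let cO : ChartedSpace (Fin (n + ℓ) → ℂ) (OrbitSpace (nerveComplex a b) Ψ) :=
    chartedSpaceOfCharts (ν.orbitChart T) fun o => hT (φ.symm o)
  let cC : ChartedSpace (Fin (n + ℓ) → ℂ) (polytopeSpace a b) :=
    chartedSpaceOfCharts (ν.complexChart T) hT
  have hR : IsManifold 𝓘(ℝ, EuclideanSpace ℝ (Fin (m + n))) ∞ (polytopeSpace a b) :=
    isManifold_chartedSpaceOfCharts _ _ fun x y =>
      contDiffOn_conj L (ν.contDiffOn_chart_transition (T x) x y (T y))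
  have hC : IsManifold 𝓘(ℂ, Fin (n + ℓ) → ℂ) ω (polytopeSpace a b) :=
    isManifold_chartedSpaceOfCharts _ _ fun x y => ν.contDiffOn_chart_transition (T x) x y (T y)
  -- The orbit charts are those of `Z_P` transported along the homeomorphism, which cancels in the
  -- transitions.
  have horbit : ∀ x y, ((ν.orbitChart T x).symm ≫ₕ ν.orbitChart T y) =
      (ν.complexChart T (φ.symm x)).symm ≫ₕ ν.complexChart T (φ.symm y) := by
    intro x y
    ext z <;> simp [Normalization.orbitChart, φ]
  have hO : IsManifold 𝓘(ℂ, Fin (n + ℓ) → ℂ) ω (OrbitSpace (nerveComplex a b) Ψ) :=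
    isManifold_chartedSpaceOfCharts _ _ fun x y => by
      rw [horbit]
      exact ν.contDiffOn_chart_transition _ _ _ _
  refine ⟨fun Γ _ hΓ => polytopeSpace_eq_hermitianQuadrics hΓ, φ.symm.isEmbedding.t2Space,
    φ.symm.isInducing.secondCountableTopology, cR, cO, hR, ν.isSmoothEmbedding_val T hmk hT L hR, hO,
    ν.isSubmersion_orbitProj T hmk hT hO, ?_, toOrbitSpace_smul a b Ψ, cC, hC, ?_, ?_⟩
  · refine ⟨⟨φ.toEquiv, ?_, ?_⟩, rfl⟩
    · refine contMDiff_of_chartAt_eq φ.continuous (L.symm : _ →L[ℝ] _) fun x y hy => ?_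
      refine (ν.orbitChart_homeomorph T x _).trans ?_
      exact (ν.complexChart T x).right_inv hy
    · refine contMDiff_of_chartAt_eq φ.symm.continuous (L : _ →L[ℝ] _) fun x y hy => ?_
      refine congrArg L (Eq.trans ?_ ((ν.complexChart T (φ.symm x)).right_inv hy))
      exact congrArg (ν.complexChart T (φ.symm x)) (φ.symm_apply_apply _)
  · refine ⟨⟨Equiv.refl _, ?_, ?_⟩, rfl⟩
    · refine contMDiff_of_chartAt_eq continuous_id (L.symm : _ →L[ℝ] _) fun x y hy => ?_
      exact (ν.complexChart T x).right_inv hy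
    · refine contMDiff_of_chartAt_eq continuous_id (L : _ →L[ℝ] _) fun x y hy => ?_
      exact congrArg L ((ν.complexChart T x).right_inv hy)
  · refine ⟨⟨φ.toEquiv, ?_, ?_⟩, rfl⟩
    · refine contMDiff_of_chartAt_eq φ.continuous (ContinuousLinearMap.id ℂ _) fun x y hy => ?_
      exact (ν.orbitChart_homeomorph T x _).trans ((ν.complexChart T x).right_inv hy)
    · refine contMDiff_of_chartAt_eq φ.symm.continuous (ContinuousLinearMap.id ℂ _)
        fun x y hy => ?_
      refine Eq.trans ?_ ((ν.complexChart T (φ.symm x)).right_inv hy)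
      exact congrArg (ν.complexChart T (φ.symm x)) (φ.symm_apply_apply _)
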